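/- Let $d\ge 2$ be an integer and $\alpha\in(0,1)$. For a measurable function $f$ on $\mathbb{R}^d$ with values in $[-\infty,\infty]$ let $f^*(t)=\inf\{y\ge 0:\ |\{|f|>y\}|<t\}$ ($t>0$) be its non-increasing rearrangement, let $f^{**}(t)=\frac1t\int_0^t f^*(s)\,ds$, and for $1<q<\infty$ let \[ \|f\|_{L^{q,1}(\mathbb{R}^d)}=\int_0^\infty t^{1/q}f^{**}(t)\,\frac{dt}{t}\in[0,\infty]. \] For $u\in L^1(\mathbb{R}^d)$ let \[ |Du|(\mathbb{R}^d)=\sup\Big\{\int_{\mathbb{R}^d}u\,\operatorname{div}\Phi\,dx:\ \Phi\in C^1_c(\mathbb{R}^d;\mathbb{R}^d),\ |\Phi|\le 1\Big\}, \] let $BV(\mathbb{R}^d)$ be the set of (real-valued) $u\in L^1(\mathbb{R}^d)$ with $|Du|(\mathbb{R}^d)<\infty$, and for $u\in BV(\mathbb{R}^d)$ let \[ \mathcal{D}^{1-\alpha}(u)(x)=\int_{\mathbb{R}^d}\frac{|u(x)-u(y)|}{|x-y|^{d+1-\alpha}}\,dy\in[0,\infty]. \] Then there exists a constant $C=C(\alpha,d)>0$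 such that for all $u\in BV(\mathbb{R}^d)$ \[ \|\mathcal{D}^{1-\alpha}(u)\|_{L^{d/(d-\alpha),1}(\mathbb{R}^d)}\le C\,\big(|Du|(\mathbb{R}^d)\big)^{1-\alpha}\,\|u\|_{L^{d/(d-1),1}(\mathbb{R}^d)}^{\alpha}. \] -/

import Mathlib

open MeasureTheory Set
open scoped ENNReal

noncomputable section

namespace LorentzBV

/-- The distribution function `m(f, y) = |{f > y}|` of a nonnegative extended-real function
(a signed function `u` enters through its modulus `‖u ·‖ₑ`). -/
def distribution {X : Type*} [MeasurableSpace X] (μ : Measure X) (f : X → ℝ≥0∞)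
    (y : ℝ≥0∞) : ℝ≥0∞ :=
  μ {x | y < f x}

/-- The nonincreasing rearrangement `f*`, the left-continuous generalized inverse of the
distribution function: `f*(t) = inf {y ≥ 0 : m(f, y) < t}` for `t > 0`. -/
def rearrangement {X : Type*} [MeasurableSpace X] (μ : Measure X) (f : X → ℝ≥0∞)
    (t : ℝ) : ℝ≥0∞ :=
  sInf {y | distribution μ f y < ENNReal.ofReal t}

/-- The averaged rearrangement `f**(t) = (1/t) ∫₀ᵗ f*(s) ds`, for `t > 0`. -/
def maximalRearrangement {X : Type*} [MeasurableSpace X] (μ : Measure X) (f : X → ℝ≥0∞)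
    (t : ℝ) : ℝ≥0∞ :=
  (∫⁻ s in Ioc 0 t, rearrangement μ f s) / ENNReal.ofReal t

/-- The Lorentz norm `‖f‖_{L^{q,r}} = (∫₀^∞ [t^{1/q} f**(t)]^r dt/t)^{1/r}`,
for `1 < q < ∞` and `1 ≤ r < ∞`. -/
def lorentzNorm {X : Type*} [MeasurableSpace X] (μ : Measure X) (q r : ℝ)
    (f : X → ℝ≥0∞) : ℝ≥0∞ :=
  (∫⁻ t in Ioi (0 : ℝ),
    (ENNReal.ofReal t ^ (1 / q) * maximalRearrangement μ f t) ^ r / ENNReal.ofReal t) ^ (1 / r)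

/-- The divergence `∑ᵢ ∂ᵢ Φᵢ` of a vector field on `ℝ^d`. -/
def divergence {d : ℕ} (Φ : EuclideanSpace ℝ (Fin d) → EuclideanSpace ℝ (Fin d))
    (x : EuclideanSpace ℝ (Fin d)) : ℝ :=
  ∑ i, fderiv ℝ Φ x (EuclideanSpace.single i 1) i

/-- The total variation `|Du|(ℝ^d)` of the distributional derivative of `u`: the supremum of
`∫ u div Φ` over `Φ ∈ C¹_c(ℝ^d; ℝ^d)` with `|Φ| ≤ 1` everywhere. -/
def totalVariation {d : ℕ} (u : EuclideanSpace ℝ (Fin d) → ℝ) : ℝ≥0∞ :=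
  ⨆ (Φ : EuclideanSpace ℝ (Fin d) → EuclideanSpace ℝ (Fin d)) (_ : ContDiff ℝ 1 Φ)
    (_ : HasCompactSupport Φ) (_ : ∀ x, ‖Φ x‖ ≤ 1),
    ENNReal.ofReal (∫ x, u x * divergence Φ x)

/-- `u ∈ BV(ℝ^d)`: `u` is integrable and `|Du|(ℝ^d)` is finite. -/
def IsBV {d : ℕ} (u : EuclideanSpace ℝ (Fin d) → ℝ) : Prop :=
  Integrable u ∧ totalVariation u < ∞

/-- The nonlinear fractional differential operator
`𝒟^s(u)(x) = ∫ |u(x) - u(y)| / |x - y|^{d+s} dy`, with values in `[0, ∞]`. -/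
def fracD {d : ℕ} (s : ℝ) (u : EuclideanSpace ℝ (Fin d) → ℝ)
    (x : EuclideanSpace ℝ (Fin d)) : ℝ≥0∞ :=
  ∫⁻ y, ‖u x - u y‖ₑ / ‖x - y‖ₑ ^ ((d : ℝ) + s)

end LorentzBV

end

namespace LorentzBV

/-! ### Power integrals -/

/-! The proof decomposes `u` into its superlevel sets F_τ = {u > τ} and uses the scalar facts
available at each level. Since |u(x+h) − u(x)| is the measure of the set of levels τ separating the
two values, 𝒟^{1-α}u(x) is an integral over pairs (τ, h) of a jump in {0, 1} against the kernel
|h|^{-(1-α)-d}. Integrating the jump in x gives ψ_τ(h) = |F_τ Δ (F_τ − h)|. Two bounds hold: ψ_τ(h)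
≤ 2M(τ) with M(τ) = |{|u| ≥ |τ|}|, and ψ_τ(h) ≤ P(τ)|h| with ∫P ≤ C|Du|. The coarea formula is not
needed for the second (`exists_levelVariation`): ψ_τ is subadditive in h, so averages of ψ_τ over
small balls control it at every h, and the L¹ translation estimate
`lintegral_enorm_translate_sub_le` with Fatou controls the integral in τ.

For fixed t, ∫₀ᵗ f* ≤ t‖f_∞‖_∞ + ‖f_1‖_1 whenever f ≤ f_∞ + f_1 with nonnegative terms. Pairs with
M(τ) > t and |h| ≥ t/P(τ) go into f_∞, where the jump is at most 1; all others go into f_1. The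
radius min(M, t)/P balances the near and far integrals, and one level costs a constant times P^{1-α}
min(M, t)^α (`level_contribution_le`).

Integrating against t^{-α/d-1} turns min(M, t)^α into M^{α-α/d} = (M^{(d-1)/d})^α. Hölder in τ then
separates (∫P)^{1-α} from (∫M^{(d-1)/d})^α, and the last integral is controlled by the L^{d/(d-1),1}
norm of `u`. -/

theorem setLIntegral_Ioo_rpow {a : ℝ} (ha : 0 < a) {r : ℝ} (hr : 0 < r) :
    ∫⁻ t in Ioo 0 r, ENNReal.ofReal t ^ (a - 1) = ENNReal.ofReal r ^ a / ENNReal.ofReal a := by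
  have h1 : IntegrableOn (fun t : ℝ => t ^ (a - 1)) (Ioo 0 r) :=
    ((intervalIntegrable_iff_integrableOn_Ioo_of_le hr.le).1
      (intervalIntegral.intervalIntegrable_rpow' (by linarith)))
  calc ∫⁻ t in Ioo 0 r, ENNReal.ofReal t ^ (a - 1)
      = ∫⁻ t in Ioo 0 r, ENNReal.ofReal (t ^ (a - 1)) :=
        setLIntegral_congr_fun measurableSet_Ioo fun t ht => ENNReal.ofReal_rpow_of_pos ht.1
    _ = ENNReal.ofReal (∫ t in Ioo 0 r, t ^ (a - 1)) := by
        rw [ofReal_integral_eq_lintegral_ofReal h1]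
        filter_upwards [ae_restrict_mem measurableSet_Ioo] with t ht
        exact Real.rpow_nonneg ht.1.le _
    _ = ENNReal.ofReal (r ^ a / a) := by
        rw [← integral_Ioc_eq_integral_Ioo, ← intervalIntegral.integral_of_le hr.le,
          integral_rpow (Or.inl (by linarith))]
        simp [Real.zero_rpow ha.ne']
    _ = _ := by rw [ENNReal.ofReal_div_of_pos ha, ENNReal.ofReal_rpow_of_pos hr]

theorem setLIntegral_Ioi_rpow {a : ℝ} (ha : 0 < a) {r : ℝ} (hr : 0 < r) :
    ∫⁻ t in Ioi r, ENNReal.ofReal t ^ (-a - 1) = ENNReal.ofReal r ^ (-a) / ENNReal.ofReal a := by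
  have h1 : IntegrableOn (fun t : ℝ => t ^ (-a - 1)) (Ioi r) :=
    integrableOn_Ioi_rpow_of_lt (by linarith) hr
  calc ∫⁻ t in Ioi r, ENNReal.ofReal t ^ (-a - 1)
      = ∫⁻ t in Ioi r, ENNReal.ofReal (t ^ (-a - 1)) :=
        setLIntegral_congr_fun measurableSet_Ioi fun t ht =>
          ENNReal.ofReal_rpow_of_pos (hr.trans ht)
    _ = ENNReal.ofReal (∫ t in Ioi r, t ^ (-a - 1)) := by
        rw [ofReal_integral_eq_lintegral_ofReal h1]
        filter_upwards [ae_restrict_mem measurableSet_Ioi] with t ht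
        exact Real.rpow_nonneg (hr.trans ht).le _
    _ = ENNReal.ofReal (r ^ (-a) / a) := by
        rw [integral_Ioi_rpow_of_lt (by linarith) hr]
        congr 1
        simp [neg_div_neg_eq]
    _ = _ := by rw [ENNReal.ofReal_div_of_pos ha, ENNReal.ofReal_rpow_of_pos hr]

theorem measurableSet_ofReal_lt (r : ℝ≥0∞) : MeasurableSet {t : ℝ | ENNReal.ofReal t < r} :=
  measurableSet_lt ENNReal.measurable_ofReal measurable_const

/-- `∫₀^r t^{a-1} dt = r^a / a`, with an extended upper bound `r`. -/
theorem lintegral_rpow_indicator_lt {a : ℝ} (ha : 0 < a) (r : ℝ≥0∞) :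
    ∫⁻ t in Ioi (0 : ℝ), {t : ℝ | ENNReal.ofReal t < r}.indicator
      (fun t => ENNReal.ofReal t ^ (a - 1)) t = r ^ a / ENNReal.ofReal a := by
  have hfin : ∀ r : ℝ≥0∞, r ≠ ∞ → ∫⁻ t in Ioi (0 : ℝ), {t : ℝ | ENNReal.ofReal t < r}.indicator
      (fun t => ENNReal.ofReal t ^ (a - 1)) t = r ^ a / ENNReal.ofReal a := by
    intro r hr
    rw [setLIntegral_indicator (measurableSet_ofReal_lt r)]
    rcases eq_or_ne r 0 with rfl | h0
    · simp [ENNReal.zero_rpow_of_pos ha]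
    · have hpos := ENNReal.toReal_pos h0 hr
      have : {t : ℝ | ENNReal.ofReal t < r} ∩ Ioi 0 = Ioo 0 r.toReal := by
        ext t
        simp only [mem_inter_iff, mem_ofPred_eq, mem_Ioi, mem_Ioo]
        constructor
        · rintro ⟨h, ht⟩; exact ⟨ht, (ENNReal.ofReal_lt_iff_lt_toReal ht.le hr).1 h⟩
        · rintro ⟨ht, h⟩; exact ⟨(ENNReal.ofReal_lt_iff_lt_toReal ht.le hr).2 h, ht⟩
      rw [this, setLIntegral_Ioo_rpow ha hpos, ENNReal.ofReal_toReal hr]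
  rcases eq_or_ne r ∞ with rfl | hr
  · rw [ENNReal.top_rpow_of_pos ha, ENNReal.top_div_of_ne_top ENNReal.ofReal_ne_top, eq_top_iff]
    -- An infinite endpoint is reached as the limit of the finite endpoints n.
    have hlim : Filter.Tendsto (fun n : ℕ => (n : ℝ≥0∞) ^ a / ENNReal.ofReal a) Filter.atTop
        (nhds (∞ ^ a / ENNReal.ofReal a)) :=
      ENNReal.Tendsto.div_const
        ((ENNReal.continuous_rpow_const.tendsto _).comp ENNReal.tendsto_nat_nhds_top)
        (Or.inl (by simp [ENNReal.top_rpow_of_pos ha]))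
    rw [ENNReal.top_rpow_of_pos ha, ENNReal.top_div_of_ne_top ENNReal.ofReal_ne_top] at hlim
    refine le_of_tendsto' hlim fun n => ?_
    rw [← hfin n (ENNReal.natCast_ne_top n)]
    refine lintegral_mono fun t => ?_
    exact indicator_le_indicator_of_subset (fun t _ => ENNReal.ofReal_lt_top) (fun _ => zero_le) t
  · exact hfin r hr

/-- `∫_r^∞ t^{-a-1} dt ≤ r^{-a} / a`, with an extended lower bound `r`. -/
theorem lintegral_rpow_indicator_ge_le {a : ℝ} (ha : 0 < a) (r : ℝ≥0∞) :
    ∫⁻ t in Ioi (0 : ℝ), {t : ℝ | ENNReal.ofReal t < r}ᶜ.indicator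
      (fun t => ENNReal.ofReal t ^ (-a - 1)) t ≤ r ^ (-a) / ENNReal.ofReal a := by
  rw [setLIntegral_indicator (measurableSet_ofReal_lt r).compl]
  rcases eq_or_ne r 0 with rfl | h0
  · rw [ENNReal.zero_rpow_of_neg (by linarith), ENNReal.top_div_of_ne_top ENNReal.ofReal_ne_top]
    exact le_top
  rcases eq_or_ne r ∞ with rfl | hr
  · simp
  have hpos := ENNReal.toReal_pos h0 hr
  have : {t : ℝ | ENNReal.ofReal t < r}ᶜ ∩ Ioi 0 = Ici r.toReal := by
    ext t
    simp only [mem_inter_iff, mem_compl_iff, mem_ofPred_eq, mem_Ioi, mem_Ici, not_lt]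
    constructor
    · rintro ⟨h, ht⟩; exact (ENNReal.le_ofReal_iff_toReal_le hr ht.le).1 h
    · intro h
      have ht := hpos.trans_le h
      exact ⟨(ENNReal.le_ofReal_iff_toReal_le hr ht.le).2 h, ht⟩
  rw [this, setLIntegral_congr Ioi_ae_eq_Ici.symm, setLIntegral_Ioi_rpow ha hpos,
    ENNReal.ofReal_toReal hr]

/-! ### Polar coordinates -/

section Polar

variable {E : Type*} [NormedAddCommGroup E] [NormedSpace ℝ E] [MeasurableSpace E]
  [BorelSpace E] [FiniteDimensional ℝ E] [Nontrivial E] (μ : Measure E) [μ.IsAddHaarMeasure]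

/-- The punctured space is the product of the unit sphere and (0, ∞), with Haar measure
corresponding to `toSphere` times y^{n-1} dy. No integrability is assumed, so divergent kernels are
covered. -/
theorem lintegral_fun_norm_addHaar {f : ℝ → ℝ≥0∞} (hf : Measurable f) :
    ∫⁻ x, f ‖x‖ ∂μ = μ.toSphere univ *
      ∫⁻ y in Ioi (0 : ℝ), ENNReal.ofReal (y ^ (Module.finrank ℝ E - 1)) * f y := by
  calc
    ∫⁻ x, f ‖x‖ ∂μ = ∫⁻ x : ({(0)}ᶜ : Set E), f (‖x.1‖) ∂(μ.comap (↑)) := by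
      rw [lintegral_subtype_comap (measurableSet_singleton _).compl fun x ↦ f (‖x‖),
        restrict_compl_singleton]
    _ = ∫⁻ x, f x.2 ∂μ.toSphere.prod (.volumeIoiPow (Module.finrank ℝ E - 1)) := by
      have := μ.measurePreserving_homeomorphUnitSphereProd.lintegral_comp
        (f := fun x => f x.2) (by fun_prop)
      simpa using this
    _ = μ.toSphere univ * ∫⁻ x : Ioi (0 : ℝ), f x ∂.volumeIoiPow (Module.finrank ℝ E - 1) := by
      rw [lintegral_prod _ (by fun_prop)]
      simp [mul_comm]
    _ = _ := by
      rw [Measure.volumeIoiPow, lintegral_withDensity_eq_lintegral_mul _ (by fun_prop)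
        (by fun_prop)]
      rw [← lintegral_subtype_comap measurableSet_Ioi]
      rfl

theorem lintegral_ball_enorm_rpow {a : ℝ} (ha : 0 < a) (r : ℝ≥0∞) :
    ∫⁻ h, {h : E | ‖h‖ₑ < r}.indicator
      (fun h => ‖h‖ₑ ^ (a - Module.finrank ℝ E)) h ∂μ =
      μ.toSphere univ * (r ^ a / ENNReal.ofReal a) := by
  have hn : 0 < Module.finrank ℝ E := Module.finrank_pos
  have := lintegral_fun_norm_addHaar μ (f := {t : ℝ | ENNReal.ofReal t < r}.indicator
      (fun t => ENNReal.ofReal t ^ (a - Module.finrank ℝ E)))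
      ((ENNReal.measurable_ofReal.pow_const _).indicator (measurableSet_ofReal_lt r))
  rw [← lintegral_rpow_indicator_lt ha r]
  convert this using 1
  · simp [indicator, ofReal_norm]
  · congr 1
    refine setLIntegral_congr_fun measurableSet_Ioi fun t (ht : 0 < t) => ?_
    simp only [indicator, mul_ite, mul_zero]
    congr 1
    rw [ENNReal.ofReal_pow ht.le, ← ENNReal.rpow_natCast, ← ENNReal.rpow_add _ _
      (by simpa using ht) ENNReal.ofReal_ne_top, Nat.cast_pred hn]
    congr 1; ring

theorem lintegral_compl_ball_enorm_rpow_le {a : ℝ} (ha : 0 < a) (r : ℝ≥0∞) :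
    ∫⁻ h, {h : E | ‖h‖ₑ < r}ᶜ.indicator
      (fun h => ‖h‖ₑ ^ (-a - Module.finrank ℝ E)) h ∂μ ≤
      μ.toSphere univ * (r ^ (-a) / ENNReal.ofReal a) := by
  have hn : 0 < Module.finrank ℝ E := Module.finrank_pos
  have := lintegral_fun_norm_addHaar μ (f := {t : ℝ | ENNReal.ofReal t < r}ᶜ.indicator
      (fun t => ENNReal.ofReal t ^ (-a - Module.finrank ℝ E)))
      ((ENNReal.measurable_ofReal.pow_const _).indicator (measurableSet_ofReal_lt r).compl)
  refine le_trans (le_of_eq ?_) (mul_le_mul_right (lintegral_rpow_indicator_ge_le ha r) _)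
  convert this using 1
  · simp [indicator, ofReal_norm]
  · congr 1
    refine setLIntegral_congr_fun measurableSet_Ioi fun t (ht : 0 < t) => ?_
    simp only [indicator, mul_ite, mul_zero]
    congr 1
    rw [ENNReal.ofReal_pow ht.le, ← ENNReal.rpow_natCast, ← ENNReal.rpow_add _ _
      (by simpa using ht) ENNReal.ofReal_ne_top, Nat.cast_pred hn]
    congr 1; ring

end Polar

/-! ### Translation estimate for functions of bounded variation -/

/-- The factor a/√(a² + δ²) is a smooth substitute for the sign of a. The loss is at most δ because
√(a² + δ²) ≤ |a| + δ and (|a| − δ)(|a| + δ) ≤ a². -/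
theorem abs_sub_le_sq_div_sqrt (a : ℝ) {δ : ℝ} (hδ : 0 < δ) :
    |a| - δ ≤ a * (a / √(a ^ 2 + δ ^ 2)) := by
  have hpos : 0 < √(a ^ 2 + δ ^ 2) := Real.sqrt_pos.2 (by positivity)
  have hle : √(a ^ 2 + δ ^ 2) ≤ |a| + δ := by
    rw [Real.sqrt_le_left (by positivity)]
    nlinarith [sq_abs a, mul_nonneg (abs_nonneg a) hδ.le]
  rw [← mul_div_assoc, le_div_iff₀ hpos]
  rcases le_total (|a| - δ) 0 with h | h
  · nlinarith [mul_nonneg (sub_nonneg.2 h) hpos.le, mul_self_nonneg a]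
  · nlinarith [mul_le_mul_of_nonneg_left hle h, sq_abs a]

/-- The `L¹` norm is the supremum of the pairings with `C¹` compactly supported functions bounded
by one. -/
theorem integral_norm_le_of_forall_testFunction {E : Type*} [NormedAddCommGroup E]
    [NormedSpace ℝ E] [FiniteDimensional ℝ E] [MeasurableSpace E] [BorelSpace E]
    {μ : Measure E} [IsFiniteMeasureOnCompacts μ] {w : E → ℝ} (hw : Integrable w μ) {c : ℝ}
    (hc : ∀ φ : E → ℝ, ContDiff ℝ 1 φ → HasCompactSupport φ → (∀ x, |φ x| ≤ 1) →
      ∫ x, w x * φ x ∂μ ≤ c) :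
    ∫ x, ‖w x‖ ∂μ ≤ c := by
  refine le_of_forall_pos_le_add fun ε hε => ?_
  obtain ⟨g, hgc, hgs, hg⟩ := (memLp_one_iff_integrable.2 hw).exist_eLpNorm_sub_le
    ENNReal.one_ne_top le_rfl (ε := ε / 3) (by positivity)
  have hgi : Integrable g μ := hgs.continuous.integrable_of_hasCompactSupport hgc
  have hwg : ∫ x, ‖w x - g x‖ ∂μ ≤ ε / 3 := by
    rw [eLpNorm_one_eq_lintegral_enorm] at hg
    have := integral_norm_eq_lintegral_enorm (hw.sub hgi).aestronglyMeasurable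
    simp only [Pi.sub_apply] at this hg
    rw [this]
    exact ENNReal.toReal_le_of_le_ofReal (by positivity) hg
  set K := tsupport g with hK
  have hKfin : μ K ≠ ∞ := hgc.isCompact.measure_lt_top.ne
  -- Chosen so that δ · μ(K) ≤ ε/3; the added 1 avoids division by zero.
  set δ := ε / 3 / (μ.real K + 1) with hδdef
  have hK1 : 0 < μ.real K + 1 := by positivity
  have hδ : 0 < δ := by positivity
  -- A regularised sign of the approximant `g`: it inherits smoothness and compact support from `g`
  -- and stays bounded by 1.
  set φ : E → ℝ := fun x => g x / √(g x ^ 2 + δ ^ 2) with hφ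
  have hsq : ∀ x, 0 < g x ^ 2 + δ ^ 2 := fun x => by positivity
  have hφs : ContDiff ℝ 1 φ := by
    have h1 : ContDiff ℝ 1 g := hgs.of_le (by exact_mod_cast le_top)
    exact h1.div (((h1.pow 2).add contDiff_const).sqrt fun x => (hsq x).ne')
      fun x => (Real.sqrt_pos.2 (hsq x)).ne'
  have hφc : HasCompactSupport φ := hgc.mono fun x hx hgx => hx (by simp [hφ, hgx])
  have hφ1 : ∀ x, |φ x| ≤ 1 := fun x => by
    rw [hφ, abs_div, abs_of_pos (Real.sqrt_pos.2 (hsq x)), div_le_one (Real.sqrt_pos.2 (hsq x))]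
    exact Real.abs_le_sqrt (by nlinarith [sq_nonneg δ])
  have hpt : ∀ x, ‖w x‖ ≤ w x * φ x + 2 * ‖w x - g x‖ + K.indicator (fun _ => δ) x := by
    intro x
    have h1 : ‖w x‖ ≤ ‖w x - g x‖ + |g x| := by
      have := norm_add_le (w x - g x) (g x); simpa using this
    have h2 : |g x| ≤ g x * φ x + K.indicator (fun _ => δ) x := by
      by_cases hx : x ∈ K
      · rw [indicator_of_mem hx]; linarith [abs_sub_le_sq_div_sqrt (g x) hδ]
      · rw [indicator_of_notMem hx, image_eq_zero_of_notMem_tsupport hx]; simp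
    have h3 : g x * φ x ≤ w x * φ x + ‖w x - g x‖ := by
      have h4 : |(w x - g x) * φ x| ≤ ‖w x - g x‖ := by
        rw [abs_mul]; exact mul_le_of_le_one_right (abs_nonneg _) (hφ1 x)
      linarith [(abs_le.1 h4).1]
    linarith
  have hwφ : Integrable (fun x => w x * φ x) μ :=
    hw.mul_bdd (c := 1) hφs.continuous.aestronglyMeasurable (.of_forall hφ1)
  have hi2 : Integrable (fun x => 2 * ‖w x - g x‖) μ := (hw.sub hgi).norm.const_mul 2
  have hi3 : Integrable (K.indicator fun _ => δ) μ :=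
    (integrable_indicator_iff hgc.isCompact.measurableSet).2 (integrableOn_const hKfin)
  calc ∫ x, ‖w x‖ ∂μ
      ≤ ∫ x, w x * φ x + 2 * ‖w x - g x‖ + K.indicator (fun _ => δ) x ∂μ :=
        integral_mono hw.norm ((hwφ.add hi2).add hi3) hpt
    _ = ∫ x, w x * φ x ∂μ + 2 * ∫ x, ‖w x - g x‖ ∂μ + μ.real K * δ := by
        have e1 := integral_add (hwφ.add hi2) hi3
        have e2 := integral_add hwφ hi2
        simp only [Pi.add_apply] at e1
        rw [e1, e2, integral_const_mul, integral_indicator hgc.isCompact.measurableSet,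
          setIntegral_const, smul_eq_mul]
    _ ≤ c + 2 * (ε / 3) + ε / 3 := by
        gcongr
        · exact hc φ hφs hφc hφ1
        · rw [hδdef, ← mul_div_assoc, div_le_iff₀ hK1]
          nlinarith
    _ = c + ε := by ring

section Translate

variable {d : ℕ}

theorem ofReal_integral_mul_fderiv_le_totalVariation (u : EuclideanSpace ℝ (Fin d) → ℝ)
    {φ : EuclideanSpace ℝ (Fin d) → ℝ} (hφ : ContDiff ℝ 1 φ) (hc : HasCompactSupport φ)
    (h1 : ∀ x, |φ x| ≤ 1) (v : EuclideanSpace ℝ (Fin d)) :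
    ENNReal.ofReal (∫ x, u x * fderiv ℝ φ x v) ≤ ‖v‖ₑ * totalVariation u := by
  rcases eq_or_ne v 0 with rfl | hv
  · simp
  have hv' : 0 < ‖v‖ := norm_pos_iff.2 hv
  -- An admissible field pointing along v: its norm is |φ| ≤ 1 and its divergence is the derivative
  -- of φ along v, divided by |v|.
  set Φ : EuclideanSpace ℝ (Fin d) → EuclideanSpace ℝ (Fin d) := fun x => φ x • (‖v‖⁻¹ • v)
  have hdiv : ∀ x, divergence Φ x = ‖v‖⁻¹ * fderiv ℝ φ x v := by
    intro x
    have hd : HasFDerivAt Φ ((fderiv ℝ φ x).smulRight (‖v‖⁻¹ • v)) x :=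
      ((hφ.differentiable one_ne_zero) x).hasFDerivAt.smul_const _
    have hv2 : v = ∑ i, v i • EuclideanSpace.single i (1 : ℝ) := by
      ext j; simp [Finset.sum_apply, Pi.single_apply]
    rw [divergence, hd.fderiv]
    conv_rhs => rw [hv2, map_sum, Finset.mul_sum]
    refine Finset.sum_congr rfl fun i _ => ?_
    simp only [ContinuousLinearMap.smulRight_apply, PiLp.smul_apply, smul_eq_mul, map_smul]
    rw [← hv2]
    ring
  have hΦ : ENNReal.ofReal (∫ x, u x * divergence Φ x) ≤ totalVariation u := by
    refine le_iSup_of_le Φ <| le_iSup_of_le (hφ.smul contDiff_const) <|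
      le_iSup_of_le hc.smul_right <| le_iSup_of_le (fun x => ?_) le_rfl
    rw [norm_smul, norm_smul, norm_inv, norm_norm, inv_mul_cancel₀ hv'.ne', mul_one]
    exact h1 x
  have : ∫ x, u x * fderiv ℝ φ x v = ‖v‖ * ∫ x, u x * divergence Φ x := by
    rw [← integral_const_mul]
    refine integral_congr_ae (.of_forall fun x => ?_)
    simp only [hdiv]
    field_simp
  rw [this, ENNReal.ofReal_mul (norm_nonneg _), ofReal_norm]
  gcongr

/-- `‖u(· + h) - u‖_{L¹} ≤ |h| |Du|(ℝ^d)`. -/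
theorem lintegral_enorm_translate_sub_le {u : EuclideanSpace ℝ (Fin d) → ℝ} (hu : Integrable u)
    (h : EuclideanSpace ℝ (Fin d)) :
    ∫⁻ x, ‖u (x + h) - u x‖ₑ ≤ ‖h‖ₑ * totalVariation u := by
  rcases eq_or_ne (‖h‖ₑ * totalVariation u) ∞ with htop | htop
  · rw [htop]; exact le_top
  set c := (‖h‖ₑ * totalVariation u).toReal with hcdef
  have hw : Integrable (fun x => u (x + h) - u x) := (hu.comp_add_right h).sub hu
  rw [← ENNReal.ofReal_toReal htop, ← hcdef, ← ofReal_integral_norm_eq_lintegral_enorm hw]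
  refine ENNReal.ofReal_le_ofReal (integral_norm_le_of_forall_testFunction hw ?_)
  intro φ hφ hφc hφ1
  obtain ⟨B, hB⟩ := (hφ.continuous_fderiv one_ne_zero).bounded_above_of_compact_support
    (hφc.fderiv (𝕜 := ℝ))
  have hint : ∀ s : ℝ, Integrable (fun x => u x * φ (x - s • h)) := fun s =>
    hu.mul_bdd (c := 1) (by have := hφ.continuous; fun_prop) (.of_forall fun x => hφ1 _)
  -- The translation is moved onto the test function. The pairing ∫ u φ(· − s h) is differentiable
  -- in s, with derivative at most |h| |Du|, so the mean value inequality on [0, 1] gives the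
  -- estimate.
  have hderiv : ∀ s : ℝ, HasDerivAt (fun s : ℝ => ∫ x, u x * φ (x - s • h))
      (∫ x, u x * fderiv ℝ φ (x - s • h) (-h)) s := by
    intro s
    refine (hasDerivAt_integral_of_dominated_loc_of_deriv_le
      (F' := fun s x => u x * fderiv ℝ φ (x - s • h) (-h))
      (bound := fun x => ‖u x‖ * (B * ‖h‖)) (s := univ) Filter.univ_mem
      (.of_forall fun s => (hint s).aestronglyMeasurable) (hint s) ?_ ?_ ?_ ?_).2
    · refine hu.aestronglyMeasurable.mul ?_
      have := hφ.continuous_fderiv one_ne_zero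
      fun_prop
    · refine .of_forall fun x s _ => ?_
      rw [norm_mul]
      gcongr
      refine ((fderiv ℝ φ _).le_opNorm _).trans ?_
      rw [norm_neg]
      gcongr
      exact hB _
    · exact hu.norm.mul_const _
    · refine .of_forall fun x s _ => ?_
      have h1 : HasDerivAt (fun s : ℝ => x - s • h) (-h) s := by
        simpa using ((hasDerivAt_id s).smul_const h).const_sub x
      exact (((hφ.differentiable one_ne_zero) _).hasFDerivAt.comp_hasDerivAt s h1).const_mul _
  have hbound : ∀ s : ℝ, deriv (fun s : ℝ => ∫ x, u x * φ (x - s • h)) s ≤ c := by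
    intro s
    rw [(hderiv s).deriv]
    have hs : ContDiff ℝ 1 fun x => φ (x - s • h) := hφ.comp (contDiff_id.sub contDiff_const)
    have hsc : HasCompactSupport fun x => φ (x - s • h) := by
      simpa [sub_eq_add_neg, Function.comp_def] using
        hφc.comp_homeomorph (Homeomorph.addRight (-(s • h)))
    have := ofReal_integral_mul_fderiv_le_totalVariation u hs hsc (fun x => hφ1 _) (-h)
    simp only [fderiv_comp_sub, enorm_neg] at this
    rw [hcdef, ← ENNReal.ofReal_le_iff_le_toReal htop]
    exact this
  have hmv := image_sub_le_mul_sub_of_deriv_le (fun s => (hderiv s).differentiableAt) hbound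
    (zero_le_one' ℝ)
  have e1 : ∫ x, u (x + h) * φ x = ∫ x, u x * φ (x - (1 : ℝ) • h) := by
    rw [← integral_add_right_eq_self (fun x => u x * φ (x - (1 : ℝ) • h)) h]
    simp
  have e2 : ∫ x, (u (x + h) - u x) * φ x
      = (∫ x, u x * φ (x - (1 : ℝ) • h)) - ∫ x, u x * φ (x - (0 : ℝ) • h) := by
    rw [← e1]
    simp only [sub_mul, zero_smul, sub_zero]
    refine integral_sub ?_ (by simpa using hint 0)
    exact (hu.comp_add_right h).mul_bdd (c := 1) hφ.continuous.aestronglyMeasurable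
      (.of_forall hφ1)
  rw [e2]
  linarith

end Translate

/-! ### Translations of level sets -/

/-- The indicator of the event that exactly one of `a`, `b` lies above the level `τ`. -/
noncomputable def levelJump (τ a b : ℝ) : ℝ≥0∞ :=
  open Classical in if (τ < a ↔ τ < b) then 0 else 1

theorem levelJump_le_one (τ a b : ℝ) : levelJump τ a b ≤ 1 := by
  unfold levelJump; split_ifs <;> simp

theorem levelJump_self (τ a : ℝ) : levelJump τ a a = 0 := by simp [levelJump]

theorem levelJump_triangle (τ a b c : ℝ) :
    levelJump τ a c ≤ levelJump τ a b + levelJump τ b c := by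
  unfold levelJump; split_ifs <;> first | (exfalso; tauto) | simp

/-- If |a| and |b| are both below |τ|, then a and b lie on the same side of τ, whatever its sign.
Using |τ| keeps the bound useful at negative levels, where {u > τ} itself may have infinite measure.
-/
theorem levelJump_le_indicator (τ a b : ℝ) :
    levelJump τ a b ≤ {z : ℝ | |τ| ≤ |z|}.indicator 1 a + {z : ℝ | |τ| ≤ |z|}.indicator 1 b := by
  unfold levelJump
  split_ifs with h
  · exact zero_le
  · have key : |τ| ≤ |a| ∨ |τ| ≤ |b| := by
      by_contra! hc
      apply h
      have ha := abs_lt.1 hc.1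
      have hb := abs_lt.1 hc.2
      rcases abs_cases τ with ⟨h1, _⟩ | ⟨h1, _⟩ <;> constructor <;> intro _ <;> linarith
    rcases key with hk | hk
    · exact le_add_right (by simp [indicator, hk])
    · exact le_add_left (by simp [indicator, hk])

theorem measurable_levelJump : Measurable fun p : ℝ × ℝ × ℝ => levelJump p.1 p.2.1 p.2.2 := by
  classical
  have h1 : MeasurableSet {p : ℝ × ℝ × ℝ | p.1 < p.2.1} :=
    measurableSet_lt (by fun_prop) (by fun_prop)
  have h2 : MeasurableSet {p : ℝ × ℝ × ℝ | p.1 < p.2.2} :=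
    measurableSet_lt (by fun_prop) (by fun_prop)
  have h3 : MeasurableSet {p : ℝ × ℝ × ℝ | p.1 < p.2.1 ↔ p.1 < p.2.2} := h1.iff h2
  unfold levelJump
  exact Measurable.ite h3 measurable_const measurable_const

theorem _root_.Measurable.levelJump {X : Type*} [MeasurableSpace X] {f g k : X → ℝ}
    (hf : Measurable f) (hg : Measurable g) (hk : Measurable k) :
    Measurable fun x => levelJump (f x) (g x) (k x) :=
  measurable_levelJump.comp (hf.prodMk (hg.prodMk hk))

/-- The levels separating a from b form a half-open interval of length |b − a|. This layer-cake
identity replaces the function by its level sets. -/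
theorem lintegral_levelJump (a b : ℝ) : ∫⁻ τ, levelJump τ a b = ‖b - a‖ₑ := by
  have : ∀ τ, levelJump τ a b = (Ico (min a b) (max a b)).indicator 1 τ := by
    intro τ
    unfold levelJump indicator
    have : (τ < a ↔ τ < b) ↔ ¬ τ ∈ Ico (min a b) (max a b) := by
      simp only [mem_Ico, min_le_iff, lt_max_iff]
      rw [← not_lt, ← not_lt]
      tauto
    split_ifs <;> first | rfl | tauto
  simp_rw [this]
  rw [lintegral_indicator_one measurableSet_Ico, Real.volume_Ico, max_sub_min_eq_abs,
    ← Real.norm_eq_abs, ofReal_norm]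

section Translation

set_option linter.unusedSectionVars false

variable {E : Type*} [NormedAddCommGroup E] [NormedSpace ℝ E] [MeasurableSpace E]
  [BorelSpace E] [FiniteDimensional ℝ E] (μ : Measure E) [μ.IsAddHaarMeasure]

/-- `|F_τ Δ (F_τ - h)|` for the superlevel set `F_τ = {u > τ}`. -/
noncomputable def levelTranslation (u : E → ℝ) (τ : ℝ) (h : E) : ℝ≥0∞ :=
  ∫⁻ x, levelJump τ (u x) (u (x + h)) ∂μ

variable {u : E → ℝ}

theorem measurable_levelTranslation (hu : Measurable u) :
    Measurable fun p : ℝ × E => levelTranslation μ u p.1 p.2 := by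
  refine Measurable.lintegral_prod_right' (f := fun q : (ℝ × E) × E =>
    levelJump q.1.1 (u q.2) (u (q.2 + q.1.2))) ?_
  exact Measurable.levelJump (by fun_prop) (by fun_prop) (by fun_prop)

theorem levelTranslation_zero (τ : ℝ) : levelTranslation μ u τ 0 = 0 := by
  simp [levelTranslation, levelJump_self]

/-- A jump between x and x + h + k forces one between x and x + h or between x + h and x + h + k;
translation invariance identifies the measure of the latter. -/
theorem levelTranslation_add_le (hu : Measurable u) (τ : ℝ) (h k : E) :
    levelTranslation μ u τ (h + k) ≤ levelTranslation μ u τ h + levelTranslation μ u τ k := by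
  have e : levelTranslation μ u τ k = ∫⁻ x, levelJump τ (u (x + h)) (u (x + h + k)) ∂μ :=
    (lintegral_add_right_eq_self (fun x => levelJump τ (u x) (u (x + k))) h).symm
  rw [e, levelTranslation, levelTranslation, ← lintegral_add_left
    (Measurable.levelJump (by fun_prop) (by fun_prop) (by fun_prop))]
  refine lintegral_mono fun x => ?_
  rw [← add_assoc]
  exact levelJump_triangle _ _ _ _

theorem levelTranslation_nsmul_le (hu : Measurable u) (τ : ℝ) (h : E) (n : ℕ) :
    levelTranslation μ u τ (n • h) ≤ n * levelTranslation μ u τ h := by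
  induction n with
  | zero => simp [levelTranslation_zero]
  | succ n ih =>
    rw [succ_nsmul, Nat.cast_succ, add_mul, one_mul]
    exact (levelTranslation_add_le μ hu τ _ _).trans (by gcongr)

theorem levelTranslation_le_two_mul (hu : Measurable u) (τ : ℝ) (h : E) :
    levelTranslation μ u τ h ≤ 2 * μ {x | |τ| ≤ |u x|} := by
  have hm : MeasurableSet {x | |τ| ≤ |u x|} := measurableSet_le (by fun_prop) (by fun_prop)
  calc levelTranslation μ u τ h
      ≤ ∫⁻ x, {x | |τ| ≤ |u x|}.indicator 1 x + {x | |τ| ≤ |u x|}.indicator 1 (x + h) ∂μ :=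
        lintegral_mono fun x => levelJump_le_indicator τ (u x) (u (x + h))
    _ = 2 * μ {x | |τ| ≤ |u x|} := by
        rw [lintegral_add_left (measurable_one.indicator hm), lintegral_add_right_eq_self
          (fun x => {x | |τ| ≤ |u x|}.indicator (1 : E → ℝ≥0∞) x) h, lintegral_indicator_one hm,
          two_mul]

/-- The average of `levelTranslation` over a ball of radius `ρ`, divided by `ρ` and normalised. -/
noncomputable def levelQuotient (u : E → ℝ) (ρ τ : ℝ) : ℝ≥0∞ :=
  2 * (∫⁻ k in Metric.ball (0 : E) ρ, levelTranslation μ u τ k ∂μ) *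
    (ENNReal.ofReal ρ * μ (Metric.ball 0 (ρ / 2)))⁻¹

theorem measurable_levelQuotient (hu : Measurable u) (ρ : ℝ) :
    Measurable fun τ => levelQuotient μ u ρ τ := by
  unfold levelQuotient
  exact ((measurable_levelTranslation μ hu).lintegral_prod_right').const_mul 2 |>.mul_const _

/-- For k in the ball of radius ρ/2 about h/2, both k and h − k lie in the ball of radius ρ about 0.
Averaging ψ(h) ≤ ψ(k) + ψ(h − k) over such k bounds a pointwise value by a mean. -/
theorem levelTranslation_mul_measure_ball_le (hu : Measurable u) (τ : ℝ) {ρ : ℝ} {h : E}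
    (hh : ‖h‖ ≤ ρ) :
    levelTranslation μ u τ h * μ (Metric.ball 0 (ρ / 2)) ≤
      2 * ∫⁻ k in Metric.ball (0 : E) ρ, levelTranslation μ u τ k ∂μ := by
  set ψ := levelTranslation μ u τ with hψ
  have hψm : Measurable ψ := (measurable_levelTranslation μ hu).comp measurable_prodMk_left
  set B := Metric.ball ((2 : ℝ)⁻¹ • h) (ρ / 2) with hB
  have hsub : ∀ k ∈ B, k ∈ Metric.ball (0 : E) ρ ∧ h - k ∈ Metric.ball (0 : E) ρ := by
    intro k hk
    rw [hB, mem_ball_iff_norm] at hk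
    have h2 : ‖(2 : ℝ)⁻¹ • h‖ ≤ ρ / 2 := by
      rw [norm_smul]; norm_num; linarith
    rw [mem_ball_zero_iff, mem_ball_zero_iff]
    constructor
    · have := norm_add_le (k - (2 : ℝ)⁻¹ • h) ((2 : ℝ)⁻¹ • h)
      rw [sub_add_cancel] at this
      linarith
    · have := norm_sub_le ((2 : ℝ)⁻¹ • h) (k - (2 : ℝ)⁻¹ • h)
      have e : (2 : ℝ)⁻¹ • h - (k - (2 : ℝ)⁻¹ • h) = h - k := by module
      rw [e] at this
      linarith
  have hmb := (Metric.isOpen_ball (x := (0 : E)) (ε := ρ)).measurableSet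
  calc ψ h * μ (Metric.ball 0 (ρ / 2)) = ∫⁻ k in B, ψ h ∂μ := by
        rw [setLIntegral_const, hB, Measure.addHaar_ball_center μ ((2 : ℝ)⁻¹ • h)]
    _ ≤ ∫⁻ k in B, (Metric.ball (0 : E) ρ).indicator ψ k
          + (Metric.ball (0 : E) ρ).indicator ψ (h - k) ∂μ := by
        refine setLIntegral_mono' Metric.isOpen_ball.measurableSet fun k hk => ?_
        rw [indicator_of_mem (hsub k hk).1, indicator_of_mem (hsub k hk).2]
        have := levelTranslation_add_le μ hu τ k (h - k)
        rwa [add_sub_cancel] at this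
    _ ≤ ∫⁻ k, (Metric.ball (0 : E) ρ).indicator ψ k
          + (Metric.ball (0 : E) ρ).indicator ψ (h - k) ∂μ := setLIntegral_le_lintegral _ _
    _ = 2 * ∫⁻ k in Metric.ball (0 : E) ρ, ψ k ∂μ := by
        rw [lintegral_add_left (hψm.indicator hmb), lintegral_sub_left_eq_self
          (fun k => (Metric.ball (0 : E) ρ).indicator ψ k) h, lintegral_indicator hmb, two_mul]

theorem levelTranslation_le_levelQuotient (hu : Measurable u) (τ : ℝ) {ρ : ℝ} (hρ : 0 < ρ)
    {h : E} (hh : ‖h‖ ≤ ρ) :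
    levelTranslation μ u τ h ≤ ENNReal.ofReal ρ * levelQuotient μ u ρ τ := by
  have hb0 : μ (Metric.ball (0 : E) (ρ / 2)) ≠ 0 := (Metric.measure_ball_pos μ _ (by positivity)).ne'
  have hbt : μ (Metric.ball (0 : E) (ρ / 2)) ≠ ∞ := measure_ball_lt_top.ne
  have hρ0 : ENNReal.ofReal ρ ≠ 0 := by simpa using hρ
  have h1 := levelTranslation_mul_measure_ball_le μ hu τ hh
  have e : ENNReal.ofReal ρ * levelQuotient μ u ρ τ =
      2 * (∫⁻ k in Metric.ball (0 : E) ρ, levelTranslation μ u τ k ∂μ) /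
        μ (Metric.ball (0 : E) (ρ / 2)) * (ENNReal.ofReal ρ * (ENNReal.ofReal ρ)⁻¹) := by
    rw [levelQuotient, ENNReal.mul_inv (Or.inl hρ0) (Or.inl ENNReal.ofReal_ne_top),
      ENNReal.div_eq_inv_mul]
    ring
  rw [e, ENNReal.mul_inv_cancel hρ0 ENNReal.ofReal_ne_top, mul_one]
  exact (ENNReal.le_div_iff_mul_le (Or.inl hb0) (Or.inl hbt)).2 h1

/-- A long translation is cut into N = ⌈‖h‖/ρ⌉ equal steps of length at most ρ. Rounding up costs
the factor 2, since Nρ ≤ ‖h‖ + ρ ≤ 2‖h‖. -/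
theorem levelTranslation_le_mul_enorm (hu : Measurable u) (τ : ℝ) {ρ : ℝ} (hρ : 0 < ρ) {h : E}
    (hh : ρ ≤ ‖h‖) :
    levelTranslation μ u τ h ≤ 2 * levelQuotient μ u ρ τ * ‖h‖ₑ := by
  set N := ⌈‖h‖ / ρ⌉₊ with hN
  have hdiv : 0 < ‖h‖ / ρ := div_pos (hρ.trans_le hh) hρ
  have hN0 : 0 < (N : ℝ) := Nat.cast_pos.2 (Nat.ceil_pos.2 hdiv)
  have hN1 : ‖h‖ ≤ N * ρ := by
    rw [← div_le_iff₀ hρ]; exact Nat.le_ceil _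
  have hN2 : N * ρ ≤ 2 * ‖h‖ := by
    have := (Nat.ceil_lt_add_one hdiv.le).le
    have h2 : N * ρ ≤ (‖h‖ / ρ + 1) * ρ := by gcongr
    rw [add_mul, div_mul_cancel₀ _ hρ.ne'] at h2
    linarith
  have e : h = N • ((N : ℝ)⁻¹ • h) := by
    rw [← Nat.cast_smul_eq_nsmul ℝ, smul_smul, mul_inv_cancel₀ hN0.ne', one_smul]
  have hsmall : ‖(N : ℝ)⁻¹ • h‖ ≤ ρ := by
    rw [norm_smul, norm_inv, Real.norm_natCast, inv_mul_le_iff₀ hN0]; exact hN1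
  calc levelTranslation μ u τ h
      ≤ N * levelTranslation μ u τ ((N : ℝ)⁻¹ • h) := by
        conv_lhs => rw [e]
        exact levelTranslation_nsmul_le μ hu τ _ N
    _ ≤ N * (ENNReal.ofReal ρ * levelQuotient μ u ρ τ) := by
        gcongr; exact levelTranslation_le_levelQuotient μ hu τ hρ hsmall
    _ = ENNReal.ofReal (N * ρ) * levelQuotient μ u ρ τ := by
        rw [ENNReal.ofReal_mul hN0.le, ENNReal.ofReal_natCast, mul_assoc]
    _ ≤ ENNReal.ofReal (2 * ‖h‖) * levelQuotient μ u ρ τ := by gcongr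
    _ = _ := by
        rw [ENNReal.ofReal_mul zero_le_two, ofReal_norm]; norm_num; ring

theorem lintegral_levelTranslation (hu : Measurable u) (h : E) :
    ∫⁻ τ, levelTranslation μ u τ h = ∫⁻ x, ‖u (x + h) - u x‖ₑ ∂μ := by
  unfold levelTranslation
  rw [lintegral_lintegral_swap]
  · simp_rw [lintegral_levelJump]
  · exact (Measurable.levelJump (by fun_prop) (by fun_prop) (by fun_prop)).aemeasurable

/-- By Tonelli, integrating over levels first recovers the L¹ modulus of `u`, at most ρV on the
ball. The ratio of the balls of radii ρ and ρ/2 gives 2^n, so the bound is uniform in ρ. -/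
theorem lintegral_levelQuotient_le (hu : Measurable u) {V : ℝ≥0∞}
    (hV : ∀ h, ∫⁻ x, ‖u (x + h) - u x‖ₑ ∂μ ≤ ‖h‖ₑ * V) {ρ : ℝ} (hρ : 0 < ρ) :
    ∫⁻ τ, levelQuotient μ u ρ τ ≤ 2 * 2 ^ Module.finrank ℝ E * V := by
  have hψ := measurable_levelTranslation μ hu
  have hb0 : μ (Metric.ball (0 : E) (ρ / 2)) ≠ 0 := (Metric.measure_ball_pos μ _ (by positivity)).ne'
  have hbt : μ (Metric.ball (0 : E) (ρ / 2)) ≠ ∞ := measure_ball_lt_top.ne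
  have hρ0 : ENNReal.ofReal ρ ≠ 0 := by simpa using hρ
  have hball : μ (Metric.ball (0 : E) ρ) =
      2 ^ Module.finrank ℝ E * μ (Metric.ball (0 : E) (ρ / 2)) := by
    have := Measure.addHaar_ball_mul_of_pos μ (0 : E) (zero_lt_two' ℝ) (ρ / 2)
    rw [mul_div_cancel₀ _ two_ne_zero] at this
    rw [this, ENNReal.ofReal_pow zero_le_two]
    norm_num
  have h1 : ∫⁻ τ, ∫⁻ k in Metric.ball (0 : E) ρ, levelTranslation μ u τ k ∂μ ≤
      ENNReal.ofReal ρ * V * μ (Metric.ball (0 : E) ρ) := by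
    rw [lintegral_lintegral_swap hψ.aemeasurable, ← setLIntegral_const]
    refine setLIntegral_mono' Metric.isOpen_ball.measurableSet fun k hk => ?_
    rw [lintegral_levelTranslation μ hu]
    refine (hV k).trans ?_
    gcongr
    rw [← ofReal_norm]
    exact ENNReal.ofReal_le_ofReal (mem_ball_zero_iff.1 hk).le
  unfold levelQuotient
  rw [lintegral_mul_const' _ _ (by simp [hb0, hρ]), lintegral_const_mul' _ _ (by simp),
    ← div_eq_mul_inv]
  refine ENNReal.div_le_of_le_mul ?_
  calc _ ≤ 2 * (ENNReal.ofReal ρ * V * μ (Metric.ball (0 : E) ρ)) := by gcongr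
    _ = _ := by rw [hball]; ring

/-- A level-set variation `P` with `|F_τ Δ (F_τ - h)| ≤ P(τ) |h|`, whose integral is controlled by
the `L¹` modulus of continuity of `u`. -/
theorem exists_levelVariation (hu : Measurable u) {V : ℝ≥0∞}
    (hV : ∀ h, ∫⁻ x, ‖u (x + h) - u x‖ₑ ∂μ ≤ ‖h‖ₑ * V) :
    ∃ P : ℝ → ℝ≥0∞, Measurable P ∧ (∀ τ h, levelTranslation μ u τ h ≤ P τ * ‖h‖ₑ) ∧
      ∫⁻ τ, P τ ≤ 4 * 2 ^ Module.finrank ℝ E * V := by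
  set ρ : ℕ → ℝ := fun n => 1 / ((n : ℝ) + 1) with hρdef
  have hρ : ∀ n, 0 < ρ n := fun n => Nat.one_div_pos_of_nat
  have hQ : ∀ n, Measurable fun τ => levelQuotient μ u (ρ n) τ :=
    fun n => measurable_levelQuotient μ hu _
  -- Each h ≠ 0 eventually satisfies ρ_n < ‖h‖, so the linear bound at scale ρ_n survives in the
  -- lower limit, and Fatou preserves the integral bound.
  refine ⟨fun τ => Filter.liminf (fun n => 2 * levelQuotient μ u (ρ n) τ) Filter.atTop,
    .liminf fun n => (hQ n).const_mul 2, ?_, ?_⟩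
  · intro τ h
    rcases eq_or_ne h 0 with rfl | hh
    · simp [levelTranslation_zero]
    have h0 : ‖h‖ₑ ≠ 0 := by simpa using hh
    rw [← ENNReal.div_le_iff h0 enorm_ne_top]
    refine Filter.le_liminf_of_le (by isBoundedDefault) ?_
    have hev : ∀ᶠ n in Filter.atTop, ρ n < ‖h‖ :=
      tendsto_one_div_add_atTop_nhds_zero_nat.eventually_lt_const (norm_pos_iff.2 hh)
    filter_upwards [hev] with n hn
    rw [ENNReal.div_le_iff h0 enorm_ne_top]
    exact levelTranslation_le_mul_enorm μ hu τ (hρ n) hn.le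
  · refine (lintegral_liminf_le fun n => (hQ n).const_mul 2).trans ?_
    refine Filter.liminf_le_of_frequently_le' (Filter.Frequently.of_forall fun n => ?_)
    rw [lintegral_const_mul' _ _ (by simp)]
    refine (mul_le_mul_right (lintegral_levelQuotient_le μ hu hV (hρ n)) _).trans (le_of_eq ?_)
    ring

end Translation

/-! ### Rearrangements -/

section Rearrangement

variable {X : Type*} [MeasurableSpace X] {μ : Measure X}

theorem distribution_congr_ae {f g : X → ℝ≥0∞} (h : f =ᵐ[μ] g) :
    distribution μ f = distribution μ g := by
  funext y
  refine measure_congr ?_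
  filter_upwards [h] with x hx
  exact propext (by change y < f x ↔ y < g x; rw [hx])

theorem lorentzNorm_congr_ae {f g : X → ℝ≥0∞} (h : f =ᵐ[μ] g) (q r : ℝ) :
    lorentzNorm μ q r f = lorentzNorm μ q r g := by
  unfold lorentzNorm maximalRearrangement rearrangement
  rw [distribution_congr_ae h]

theorem rearrangement_antitone (f : X → ℝ≥0∞) : Antitone (rearrangement μ f) :=
  fun _ _ hst => sInf_le_sInf fun _ hy => lt_of_lt_of_le hy (ENNReal.ofReal_le_ofReal hst)

theorem rearrangement_le_const_add {f g : X → ℝ≥0∞} {y : ℝ≥0∞} (h : ∀ x, f x ≤ y + g x)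
    (s : ℝ) : rearrangement μ f s ≤ y + rearrangement μ g s := by
  rw [← tsub_le_iff_left]
  refine le_sInf fun z hz => ?_
  rw [tsub_le_iff_left]
  refine sInf_le (lt_of_le_of_lt (measure_mono fun x hx => ?_) hz)
  by_contra hzx
  exact absurd (lt_of_lt_of_le hx (h x))
    (not_lt.2 (add_le_add le_rfl (not_lt.1 hzx)))

theorem ofReal_le_distribution_of_lt_rearrangement {f : X → ℝ≥0∞} {y : ℝ≥0∞} {s : ℝ}
    (h : y < rearrangement μ f s) : ENNReal.ofReal s ≤ distribution μ f y := by
  by_contra hc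
  have hle : rearrangement μ f s ≤ y := sInf_le (not_le.1 hc)
  exact absurd hle (not_le.2 h)

theorem lintegral_indicator_ofReal_lt (a : ℝ≥0∞) :
    ∫⁻ t in Ioi (0 : ℝ), {t : ℝ | ENNReal.ofReal t < a}.indicator 1 t = a := by
  have := lintegral_rpow_indicator_lt one_pos a
  simpa [Pi.one_def] using this

theorem lintegral_indicator_ofReal_le (a : ℝ≥0∞) :
    ∫⁻ t in Ioi (0 : ℝ), {t : ℝ | ENNReal.ofReal t ≤ a}.indicator 1 t ≤ a := by
  rcases eq_or_ne a ∞ with rfl | ha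
  · exact le_top
  have hm : MeasurableSet {t : ℝ | ENNReal.ofReal t ≤ a} :=
    measurableSet_le ENNReal.measurable_ofReal measurable_const
  rw [lintegral_indicator_one hm, Measure.restrict_apply hm]
  calc volume ({t : ℝ | ENNReal.ofReal t ≤ a} ∩ Ioi 0) ≤ volume (Ioc 0 a.toReal) :=
        measure_mono fun t ht => ⟨ht.2, (ENNReal.ofReal_le_iff_le_toReal ha).1 ht.1⟩
    _ = a := by rw [Real.volume_Ioc, sub_zero, ENNReal.ofReal_toReal ha]

/-- Both integrals are areas of subgraphs. At height y, every s with y < g*(s) satisfies s ≤ |{g >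
y}|, so the slices compare; only this direction is needed. -/
theorem lintegral_rearrangement_le [SFinite μ] {g : X → ℝ≥0∞} (hg : Measurable g) :
    ∫⁻ s in Ioi (0 : ℝ), rearrangement μ g s ≤ ∫⁻ x, g x ∂μ := by
  have hr : Measurable (rearrangement μ g) := (rearrangement_antitone g).measurable
  have hS : MeasurableSet {p : ℝ × ℝ | ENNReal.ofReal p.2 < rearrangement μ g p.1} :=
    measurableSet_lt (by fun_prop) (by fun_prop)
  have hT : MeasurableSet {p : ℝ × X | ENNReal.ofReal p.1 < g p.2} :=
    measurableSet_lt (by fun_prop) (by fun_prop)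
  calc ∫⁻ s in Ioi (0 : ℝ), rearrangement μ g s
      = ∫⁻ s in Ioi (0 : ℝ), ∫⁻ y in Ioi (0 : ℝ),
          {p : ℝ × ℝ | ENNReal.ofReal p.2 < rearrangement μ g p.1}.indicator 1 (s, y) := by
        refine lintegral_congr fun s => ?_
        exact (lintegral_indicator_ofReal_lt _).symm
    _ = ∫⁻ y in Ioi (0 : ℝ), ∫⁻ s in Ioi (0 : ℝ),
          {p : ℝ × ℝ | ENNReal.ofReal p.2 < rearrangement μ g p.1}.indicator 1 (s, y) :=
        lintegral_lintegral_swap (measurable_one.indicator hS).aemeasurable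
    _ ≤ ∫⁻ y in Ioi (0 : ℝ), distribution μ g (ENNReal.ofReal y) := by
        refine lintegral_mono fun y => ?_
        refine le_trans (lintegral_mono fun s => ?_) (lintegral_indicator_ofReal_le _)
        exact indicator_le_indicator_of_subset (t := {s : ℝ | ENNReal.ofReal s ≤
          distribution μ g (ENNReal.ofReal y)}) (s := {s : ℝ | ENNReal.ofReal y <
          rearrangement μ g s}) (f := 1)
          (fun s hs => ofReal_le_distribution_of_lt_rearrangement hs) (fun _ => zero_le) s
    _ = ∫⁻ y in Ioi (0 : ℝ), ∫⁻ x,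
          {p : ℝ × X | ENNReal.ofReal p.1 < g p.2}.indicator 1 (y, x) ∂μ := by
        refine lintegral_congr fun y => ?_
        exact (lintegral_indicator_one (measurableSet_lt measurable_const hg)).symm
    _ = ∫⁻ x, (∫⁻ y in Ioi (0 : ℝ),
          {p : ℝ × X | ENNReal.ofReal p.1 < g p.2}.indicator 1 (y, x)) ∂μ :=
        lintegral_lintegral_swap (measurable_one.indicator hT).aemeasurable
    _ = ∫⁻ x, g x ∂μ := by
        refine lintegral_congr fun x => ?_
        exact lintegral_indicator_ofReal_lt (g x)

/-- `∫₀ᵗ f* ≤ t y + ∫ g` whenever `f ≤ y + g`. -/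
theorem setLIntegral_rearrangement_le [SFinite μ] {f g : X → ℝ≥0∞} (hg : Measurable g) {y : ℝ≥0∞}
    (h : ∀ x, f x ≤ y + g x) (t : ℝ) :
    ∫⁻ s in Ioc 0 t, rearrangement μ f s ≤ ENNReal.ofReal t * y + ∫⁻ x, g x ∂μ := by
  calc ∫⁻ s in Ioc 0 t, rearrangement μ f s
      ≤ ∫⁻ s in Ioc 0 t, (y + rearrangement μ g s) :=
        lintegral_mono fun s => rearrangement_le_const_add h s
    _ = ENNReal.ofReal t * y + ∫⁻ s in Ioc 0 t, rearrangement μ g s := by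
        rw [lintegral_add_left measurable_const, setLIntegral_const, Real.volume_Ioc, sub_zero,
          mul_comm]
    _ ≤ ENNReal.ofReal t * y + ∫⁻ s in Ioi (0 : ℝ), rearrangement μ g s := by
        gcongr
        exact Ioc_subset_Ioi_self
    _ ≤ _ := by gcongr; exact lintegral_rearrangement_le hg

theorem lorentzNorm_one_eq (q : ℝ) (f : X → ℝ≥0∞) :
    lorentzNorm μ q 1 f = ∫⁻ t in Ioi (0 : ℝ), ENNReal.ofReal t ^ (1 / q - 1 - 1) *
      ∫⁻ s in Ioc 0 t, rearrangement μ f s := by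
  simp only [lorentzNorm, maximalRearrangement, ENNReal.rpow_one, div_one]
  refine setLIntegral_congr_fun measurableSet_Ioi fun t (ht : 0 < t) => ?_
  have h0 : ENNReal.ofReal t ≠ 0 := by simpa using ht
  rw [ENNReal.rpow_sub _ _ h0 ENNReal.ofReal_ne_top, ENNReal.rpow_sub _ _ h0 ENNReal.ofReal_ne_top,
    ENNReal.rpow_one]
  simp only [div_eq_mul_inv]
  ring

theorem mul_rearrangement_le_setLIntegral {f : X → ℝ≥0∞} {t : ℝ} :
    ENNReal.ofReal t * rearrangement μ f t ≤ ∫⁻ s in Ioc 0 t, rearrangement μ f s := by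
  calc ENNReal.ofReal t * rearrangement μ f t = ∫⁻ _ in Ioc 0 t, rearrangement μ f t := by
        rw [setLIntegral_const, Real.volume_Ioc, sub_zero, mul_comm]
    _ ≤ _ := setLIntegral_mono' measurableSet_Ioc fun s hs => rearrangement_antitone f hs.2

theorem le_rearrangement_of_ofReal_le {f : X → ℝ≥0∞} {z : ℝ≥0∞} {t : ℝ}
    (h : ENNReal.ofReal t ≤ μ {x | z ≤ f x}) : z ≤ rearrangement μ f t := by
  refine le_sInf fun y hy => ?_
  by_contra hc
  rw [not_le] at hc
  refine absurd hy (not_lt.2 (h.trans (measure_mono fun x hx => ?_)))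
  exact lt_of_lt_of_le hc hx

/-- `∫₀^∞ |{f ≥ z}|^{1/q} dz ≤ q⁻¹ ‖f‖_{L^{q,1}}`. -/
theorem lintegral_measure_rpow_le_lorentzNorm {q : ℝ} (hq : 0 < q) (f : X → ℝ≥0∞) :
    ∫⁻ z in Ioi (0 : ℝ), μ {x | ENNReal.ofReal z ≤ f x} ^ (1 / q) ≤
      ENNReal.ofReal (1 / q) * lorentzNorm μ q 1 f := by
  rw [lorentzNorm_one_eq]
  have hκ : 0 < 1 / q := by positivity
  generalize 1 / q = κ at hκ ⊢
  have hκ0 : ENNReal.ofReal κ ≠ 0 := by simpa using hκ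
  have hr : Measurable (rearrangement μ f) := (rearrangement_antitone f).measurable
  have hS : MeasurableSet {p : ℝ × ℝ | ENNReal.ofReal p.1 ≤ rearrangement μ f p.2} :=
    measurableSet_le (by fun_prop) (by fun_prop)
  rw [← ENNReal.div_le_iff' hκ0 ENNReal.ofReal_ne_top, div_eq_mul_inv,
    ← lintegral_mul_const' _ _ (by simpa using hκ)]
  -- Here M^κ/κ = ∫₀^M t^{κ-1} dt, and t < |{f ≥ z}| forces z ≤ f*(t). Tonelli leads to ∫ t^{κ-1}
  -- f*(t) dt, and f* ≤ f** finishes.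
  calc ∫⁻ z in Ioi (0 : ℝ), μ {x | ENNReal.ofReal z ≤ f x} ^ κ * (ENNReal.ofReal κ)⁻¹
      = ∫⁻ z in Ioi (0 : ℝ), ∫⁻ t in Ioi (0 : ℝ),
          {t : ℝ | ENNReal.ofReal t < μ {x | ENNReal.ofReal z ≤ f x}}.indicator
            (fun t => ENNReal.ofReal t ^ (κ - 1)) t := by
        refine lintegral_congr fun z => ?_
        rw [lintegral_rpow_indicator_lt hκ, div_eq_mul_inv]
    _ ≤ ∫⁻ z in Ioi (0 : ℝ), ∫⁻ t in Ioi (0 : ℝ),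
          {p : ℝ × ℝ | ENNReal.ofReal p.1 ≤ rearrangement μ f p.2}.indicator
            (fun p => ENNReal.ofReal p.2 ^ (κ - 1)) (z, t) := by
        refine lintegral_mono fun z => lintegral_mono fun t => ?_
        exact indicator_le_indicator_of_subset (t := {t : ℝ | ENNReal.ofReal z ≤
          rearrangement μ f t}) (f := fun t => ENNReal.ofReal t ^ (κ - 1))
          (fun t ht => le_rearrangement_of_ofReal_le (le_of_lt ht)) (fun _ => zero_le) t
    _ = ∫⁻ t in Ioi (0 : ℝ), ∫⁻ z in Ioi (0 : ℝ),
          {p : ℝ × ℝ | ENNReal.ofReal p.1 ≤ rearrangement μ f p.2}.indicator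
            (fun p => ENNReal.ofReal p.2 ^ (κ - 1)) (z, t) :=
        lintegral_lintegral_swap
          (Measurable.indicator (by fun_prop) hS).aemeasurable
    _ ≤ ∫⁻ t in Ioi (0 : ℝ), ENNReal.ofReal t ^ (κ - 1) * rearrangement μ f t := by
        refine lintegral_mono fun t => ?_
        have : ∀ z, {p : ℝ × ℝ | ENNReal.ofReal p.1 ≤ rearrangement μ f p.2}.indicator
            (fun p => ENNReal.ofReal p.2 ^ (κ - 1)) (z, t) = ENNReal.ofReal t ^ (κ - 1) *
            {z : ℝ | ENNReal.ofReal z ≤ rearrangement μ f t}.indicator 1 z := fun z => by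
          simp [indicator]
        simp_rw [this]
        rw [lintegral_const_mul _ (measurable_one.indicator
          (measurableSet_le ENNReal.measurable_ofReal measurable_const))]
        gcongr
        exact lintegral_indicator_ofReal_le _
    _ ≤ _ := by
        refine setLIntegral_mono' measurableSet_Ioi fun t (ht : 0 < t) => ?_
        have h0 : ENNReal.ofReal t ≠ 0 := by simpa using ht
        rw [ENNReal.rpow_sub (κ - 1) 1 h0 ENNReal.ofReal_ne_top, ENNReal.rpow_one,
          div_eq_mul_inv, mul_assoc]
        gcongr
        rw [mul_comm, ← div_eq_mul_inv,
          ENNReal.le_div_iff_mul_le (Or.inl h0) (Or.inl ENNReal.ofReal_ne_top), mul_comm]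
        exact mul_rearrangement_le_setLIntegral

end Rearrangement

/-! ### The rearrangement of the fractional difference integral -/

/-- This is the near-part cost at the balancing radius m/P. An inequality suffices and absorbs the
degenerate values 0 and ∞ of P. -/
theorem mul_div_rpow_le (P m : ℝ≥0∞) {α : ℝ} (hα : 0 < α) :
    P * (m / P) ^ α ≤ P ^ (1 - α) * m ^ α := by
  rcases eq_or_ne P 0 with rfl | h0
  · simp
  rcases eq_or_ne P ∞ with rfl | ht
  · rcases eq_or_ne m ∞ with rfl | hm
    · simp [hα]
    · simp [ENNReal.div_top, hα]
  have hP : P = P ^ (1 - α) * P ^ α := by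
    rw [← ENNReal.rpow_add _ _ h0 ht, sub_add_cancel, ENNReal.rpow_one]
  have hPα : P ^ α * (P ^ α)⁻¹ = 1 := ENNReal.mul_inv_cancel
    (by simp [h0, ht]) (ENNReal.rpow_ne_top_of_nonneg hα.le ht)
  rw [ENNReal.div_rpow_of_nonneg _ _ hα.le, div_eq_mul_inv]
  conv_lhs => enter [1]; rw [hP]
  calc P ^ (1 - α) * P ^ α * (m ^ α * (P ^ α)⁻¹)
      = P ^ (1 - α) * m ^ α * (P ^ α * (P ^ α)⁻¹) := by ring
    _ ≤ _ := by rw [hPα, mul_one]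

theorem mul_div_rpow_neg_le (P : ℝ≥0∞) {m : ℝ≥0∞} (hm : m ≠ ∞) {α : ℝ}
    (hα : α < 1) : m * (m / P) ^ (-(1 - α)) ≤ P ^ (1 - α) * m ^ α := by
  have h1 : 0 < 1 - α := by linarith
  rcases eq_or_ne m 0 with rfl | hm0
  · simp
  rcases eq_or_ne P 0 with rfl | h0
  · rw [ENNReal.div_zero hm0, ENNReal.top_rpow_of_neg (by linarith)]; simp
  rcases eq_or_ne P ∞ with rfl | ht
  · rw [ENNReal.top_rpow_of_pos h1, ENNReal.top_mul (by simp [hm0, hm])]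
    exact le_top
  have hme : m = m ^ (1 - α) * m ^ α := by
    rw [← ENNReal.rpow_add _ _ hm0 hm, sub_add_cancel, ENNReal.rpow_one]
  have hmα : m ^ (1 - α) * (m ^ (1 - α))⁻¹ = 1 := ENNReal.mul_inv_cancel
    (by simp [hm0, hm]) (ENNReal.rpow_ne_top_of_nonneg h1.le hm)
  rw [ENNReal.rpow_neg, ENNReal.div_rpow_of_nonneg _ _ h1.le, ENNReal.inv_div
    (Or.inl (ENNReal.rpow_ne_top_of_nonneg h1.le ht)) (Or.inl (by simp [h0, ht])), div_eq_mul_inv]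
  conv_lhs => enter [1]; rw [hme]
  calc m ^ (1 - α) * m ^ α * (P ^ (1 - α) * (m ^ (1 - α))⁻¹)
      = P ^ (1 - α) * m ^ α * (m ^ (1 - α) * (m ^ (1 - α))⁻¹) := by ring
    _ ≤ _ := by rw [hmα, mul_one]

section Difference

set_option linter.unusedSectionVars false

variable {E : Type*} [NormedAddCommGroup E] [NormedSpace ℝ E] [MeasurableSpace E]
  [BorelSpace E] [FiniteDimensional ℝ E] [Nontrivial E] (μ : Measure E) [μ.IsAddHaarMeasure]

/-- The integral `∫ |u(x + h) - u(x)| |h|^{-s-n} dh`. -/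
noncomputable def differenceIntegral (s : ℝ) (u : E → ℝ) (x : E) : ℝ≥0∞ :=
  ∫⁻ h, ‖u (x + h) - u x‖ₑ * ‖h‖ₑ ^ (-s - Module.finrank ℝ E) ∂μ

/-- The measure of `{|u| ≥ |τ|}`. -/
noncomputable def levelMeasure (u : E → ℝ) (τ : ℝ) : ℝ≥0∞ := μ {x | |τ| ≤ |u x|}

variable {u : E → ℝ}

theorem measurable_levelMeasure (hu : Measurable u) : Measurable (levelMeasure μ u) :=
  measurable_measure_prodMk_left (s := {p : ℝ × E | |p.1| ≤ |u p.2|})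
    (measurableSet_le (by fun_prop) (by fun_prop))

theorem lintegral_near_le {P : ℝ≥0∞} {τ α : ℝ} (hα : 0 < α)
    (hP : ∀ h, levelTranslation μ u τ h ≤ P * ‖h‖ₑ) (r : ℝ≥0∞) :
    ∫⁻ h, {h : E | ‖h‖ₑ < r}.indicator
      (fun h => levelTranslation μ u τ h * ‖h‖ₑ ^ (-(1 - α) - Module.finrank ℝ E)) h ∂μ ≤
      P * (μ.toSphere univ * (r ^ α / ENNReal.ofReal α)) := by
  have hm : MeasurableSet {h : E | ‖h‖ₑ < r} := measurableSet_lt (by fun_prop) (by fun_prop)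
  rw [← lintegral_ball_enorm_rpow μ hα r, ← lintegral_const_mul _
    (Measurable.indicator (by fun_prop) hm)]
  refine lintegral_mono fun h => ?_
  by_cases hr : h ∈ {h : E | ‖h‖ₑ < r}
  · simp only [indicator_of_mem hr]
    refine (mul_le_mul_left (hP h) _).trans ?_
    rw [mul_assoc]
    gcongr
    rcases eq_or_ne h 0 with rfl | h0
    · simp
    · have h0' : ‖h‖ₑ ≠ 0 := by simpa using h0
      conv_lhs => enter [1]; rw [← ENNReal.rpow_one ‖h‖ₑ]
      rw [← ENNReal.rpow_add _ _ h0' enorm_ne_top]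
      exact le_of_eq (by congr 1; ring)
  · simp [indicator_of_notMem hr]

/-- The contribution of one level: far increments of tall levels are measured in `L^∞`, the rest
in `L¹`. -/
theorem level_contribution_le (hu : Measurable u) {P : ℝ≥0∞} {τ α t : ℝ} (hα : 0 < α)
    (hα' : α < 1) (hP : ∀ h, levelTranslation μ u τ h ≤ P * ‖h‖ₑ) {A : Set E}
    (hA : A = {h | ENNReal.ofReal t < levelMeasure μ u τ ∧
      min (levelMeasure μ u τ) (ENNReal.ofReal t) / P ≤ ‖h‖ₑ}) :
    ENNReal.ofReal t * ∫⁻ h, A.indicator (fun h => ‖h‖ₑ ^ (-(1 - α) - Module.finrank ℝ E)) h ∂μ +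
      ∫⁻ h, Aᶜ.indicator
        (fun h => levelTranslation μ u τ h * ‖h‖ₑ ^ (-(1 - α) - Module.finrank ℝ E)) h ∂μ ≤
    μ.toSphere univ * ((ENNReal.ofReal α)⁻¹ + 2 * (ENNReal.ofReal (1 - α))⁻¹) *
      (P ^ (1 - α) * min (levelMeasure μ u τ) (ENNReal.ofReal t) ^ α) := by
  set m := min (levelMeasure μ u τ) (ENNReal.ofReal t) with hm
  have hmt : m ≠ ∞ := ne_top_of_le_ne_top ENNReal.ofReal_ne_top (min_le_right _ _)
  set r := m / P with hr
  set σ := μ.toSphere univ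
  have hS : MeasurableSet {h : E | ‖h‖ₑ < r} := measurableSet_lt (by fun_prop) (by fun_prop)
  have hψ : Measurable (levelTranslation μ u τ) :=
    (measurable_levelTranslation μ hu).comp measurable_prodMk_left
  have hnear := lintegral_near_le μ hα hP r
  have hfar := lintegral_compl_ball_enorm_rpow_le μ (sub_pos.2 hα') r
  have hN : P * (σ * (r ^ α / ENNReal.ofReal α)) ≤
      σ * (ENNReal.ofReal α)⁻¹ * (P ^ (1 - α) * m ^ α) := by
    calc _ = σ * (ENNReal.ofReal α)⁻¹ * (P * r ^ α) := by rw [div_eq_mul_inv]; ring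
      _ ≤ _ := by exact mul_le_mul_right (mul_div_rpow_le P m hα) _
  have hF : m * (σ * (r ^ (-(1 - α)) / ENNReal.ofReal (1 - α))) ≤
      σ * (ENNReal.ofReal (1 - α))⁻¹ * (P ^ (1 - α) * m ^ α) := by
    calc _ = σ * (ENNReal.ofReal (1 - α))⁻¹ * (m * r ^ (-(1 - α))) := by rw [div_eq_mul_inv]; ring
      _ ≤ _ := by exact mul_le_mul_right (mul_div_rpow_neg_le P hmt hα') _
  rcases lt_or_ge (ENNReal.ofReal t) (levelMeasure μ u τ) with hlt | hle
  · have hA' : A = {h : E | ‖h‖ₑ < r}ᶜ := by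
      rw [hA]; ext h; simp [hlt]
    have hmeq : m = ENNReal.ofReal t := min_eq_right hlt.le
    rw [hA', compl_compl, ← hmeq]
    calc _ ≤ m * (σ * (r ^ (-(1 - α)) / ENNReal.ofReal (1 - α))) +
          P * (σ * (r ^ α / ENNReal.ofReal α)) := by gcongr
      _ ≤ σ * (ENNReal.ofReal (1 - α))⁻¹ * (P ^ (1 - α) * m ^ α) +
          σ * (ENNReal.ofReal α)⁻¹ * (P ^ (1 - α) * m ^ α) := add_le_add hF hN
      _ = σ * ((ENNReal.ofReal α)⁻¹ + 1 * (ENNReal.ofReal (1 - α))⁻¹) *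
          (P ^ (1 - α) * m ^ α) := by ring
      _ ≤ _ := by gcongr; exact one_le_two
  -- At a low level nothing goes into the sup part. Far increments are instead controlled by ψ ≤ 2M,
  -- the source of the factor 2 in the constant.
  · have hA' : A = ∅ := by
      rw [hA]; ext h; simp [hle.not_gt]
    have hmeq : m = levelMeasure μ u τ := min_eq_left hle
    rw [hA']
    simp only [indicator_empty, lintegral_zero, mul_zero, zero_add, compl_empty, indicator_univ]
    calc ∫⁻ h, levelTranslation μ u τ h * ‖h‖ₑ ^ (-(1 - α) - Module.finrank ℝ E) ∂μ
        ≤ ∫⁻ h, ({h : E | ‖h‖ₑ < r}.indicator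
            (fun h => levelTranslation μ u τ h * ‖h‖ₑ ^ (-(1 - α) - Module.finrank ℝ E)) h +
            2 * m * {h : E | ‖h‖ₑ < r}ᶜ.indicator
              (fun h => ‖h‖ₑ ^ (-(1 - α) - Module.finrank ℝ E)) h) ∂μ := by
          refine lintegral_mono fun h => ?_
          by_cases hh : h ∈ {h : E | ‖h‖ₑ < r}
          · rw [indicator_of_mem hh]; exact le_self_add
          · rw [indicator_of_notMem hh, indicator_of_mem (mem_compl hh), zero_add, hmeq]
            gcongr
            exact levelTranslation_le_two_mul μ hu τ h
      _ = ∫⁻ h, {h : E | ‖h‖ₑ < r}.indicator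
            (fun h => levelTranslation μ u τ h * ‖h‖ₑ ^ (-(1 - α) - Module.finrank ℝ E)) h ∂μ +
          2 * m * ∫⁻ h, {h : E | ‖h‖ₑ < r}ᶜ.indicator
              (fun h => ‖h‖ₑ ^ (-(1 - α) - Module.finrank ℝ E)) h ∂μ := by
          rw [lintegral_add_left (Measurable.indicator (by fun_prop) hS), lintegral_const_mul _
            (Measurable.indicator (by fun_prop) hS.compl)]
      _ ≤ P * (σ * (r ^ α / ENNReal.ofReal α)) +
          2 * m * (σ * (r ^ (-(1 - α)) / ENNReal.ofReal (1 - α))) := by gcongr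
      _ = P * (σ * (r ^ α / ENNReal.ofReal α)) +
          2 * (m * (σ * (r ^ (-(1 - α)) / ENNReal.ofReal (1 - α)))) := by ring
      _ ≤ σ * (ENNReal.ofReal α)⁻¹ * (P ^ (1 - α) * m ^ α) +
          2 * (σ * (ENNReal.ofReal (1 - α))⁻¹ * (P ^ (1 - α) * m ^ α)) := by gcongr
      _ = _ := by ring

/-- The cut is made in (τ, h)-space, independently of x. On A the jump is replaced by 1, giving a
constant function of x; off A the x-integral of the jump is ψ_τ(h). The estimate then reduces to one
level at a time. -/
theorem setLIntegral_rearrangement_differenceIntegral_le (hu : Measurable u) {P : ℝ → ℝ≥0∞}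
    (hPm : Measurable P) {α : ℝ} (hα : 0 < α) (hα' : α < 1)
    (hP : ∀ τ h, levelTranslation μ u τ h ≤ P τ * ‖h‖ₑ) (t : ℝ) :
    ∫⁻ s in Ioc 0 t, rearrangement μ (differenceIntegral μ (1 - α) u) s ≤
      μ.toSphere univ * ((ENNReal.ofReal α)⁻¹ + 2 * (ENNReal.ofReal (1 - α))⁻¹) *
        ∫⁻ τ, P τ ^ (1 - α) * min (levelMeasure μ u τ) (ENNReal.ofReal t) ^ α := by
  have hM := measurable_levelMeasure μ hu
  have hψ := measurable_levelTranslation μ hu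
  set K : E → ℝ≥0∞ := fun h => ‖h‖ₑ ^ (-(1 - α) - Module.finrank ℝ E) with hK
  have hKm : Measurable K := by fun_prop
  set A : Set (ℝ × E) := {p | ENNReal.ofReal t < levelMeasure μ u p.1 ∧
    min (levelMeasure μ u p.1) (ENNReal.ofReal t) / P p.1 ≤ ‖p.2‖ₑ} with hAdef
  have hA₁ : MeasurableSet {p : ℝ × E | ENNReal.ofReal t < levelMeasure μ u p.1} :=
    measurableSet_lt (by fun_prop) (by fun_prop)
  have hA₂ : MeasurableSet {p : ℝ × E |
      min (levelMeasure μ u p.1) (ENNReal.ofReal t) / P p.1 ≤ ‖p.2‖ₑ} :=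
    measurableSet_le (by fun_prop) (by fun_prop)
  have hA : MeasurableSet A := hA₁.inter hA₂
  have hJ : Measurable fun q : E × ℝ × E => levelJump q.2.1 (u q.1) (u (q.1 + q.2.2)) :=
    Measurable.levelJump (by fun_prop) (by fun_prop) (by fun_prop)
  set G : E × ℝ × E → ℝ≥0∞ := fun q => Aᶜ.indicator
    (fun p => levelJump p.1 (u q.1) (u (q.1 + p.2)) * K p.2) q.2 with hG
  have hGm : Measurable G := by
    have : G = (Prod.snd ⁻¹' Aᶜ).indicator
        (fun q : E × ℝ × E => levelJump q.2.1 (u q.1) (u (q.1 + q.2.2)) * K q.2.2) := by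
      ext q; simp [hG, indicator]
    rw [this]
    exact (hJ.mul (by fun_prop)).indicator (measurable_snd hA.compl)
  set Y : ℝ × E → ℝ≥0∞ := A.indicator fun p => K p.2 with hY
  have hYm : Measurable Y := Measurable.indicator (by fun_prop) hA
  set Z : ℝ × E → ℝ≥0∞ := Aᶜ.indicator fun p => levelTranslation μ u p.1 p.2 * K p.2 with hZ
  have hZm : Measurable Z := Measurable.indicator (by fun_prop) hA.compl
  have hGi : Measurable fun x => ∫⁻ p, G (x, p) ∂(volume.prod μ) := hGm.lintegral_prod_right'
  have hle : ∀ x, differenceIntegral μ (1 - α) u x ≤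
      ∫⁻ p, Y p ∂(volume.prod μ) + ∫⁻ p, G (x, p) ∂(volume.prod μ) := by
    intro x
    rw [← lintegral_add_left hYm]
    have hJx : Measurable fun p : ℝ × E => levelJump p.1 (u x) (u (x + p.2)) * K p.2 :=
      (Measurable.levelJump (by fun_prop) (by fun_prop) (by fun_prop)).mul (by fun_prop)
    have e : differenceIntegral μ (1 - α) u x =
        ∫⁻ p, levelJump p.1 (u x) (u (x + p.2)) * K p.2 ∂(volume.prod μ) := by
      rw [lintegral_prod_symm _ hJx.aemeasurable]
      refine lintegral_congr fun h => ?_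
      simp only
      rw [lintegral_mul_const _ (Measurable.levelJump (by fun_prop) (by fun_prop) (by fun_prop)),
        lintegral_levelJump]
    rw [e]
    refine lintegral_mono fun p => ?_
    by_cases hp : p ∈ A
    · refine le_trans ?_ le_self_add
      rw [hY, indicator_of_mem hp]
      exact mul_le_of_le_one_left' (levelJump_le_one _ _ _)
    · refine le_trans ?_ le_add_self
      simp only [hG]
      rw [indicator_of_mem (mem_compl hp)]
  have hGint : ∫⁻ x, ∫⁻ p, G (x, p) ∂(volume.prod μ) ∂μ = ∫⁻ p, Z p ∂(volume.prod μ) := by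
    rw [lintegral_lintegral_swap hGm.aemeasurable]
    refine lintegral_congr fun p => ?_
    by_cases hp : p ∈ A
    · simp [hG, hZ, hp]
    · simp only [hG, hZ, indicator_of_mem (mem_compl hp)]
      rw [lintegral_mul_const _ (Measurable.levelJump (by fun_prop) (by fun_prop) (by fun_prop)),
        levelTranslation]
  refine (setLIntegral_rearrangement_le hGi hle t).trans ?_
  rw [hGint, lintegral_prod _ hYm.aemeasurable, lintegral_prod _ hZm.aemeasurable,
    ← lintegral_const_mul _ hYm.lintegral_prod_right', ← lintegral_add_right _
    hZm.lintegral_prod_right', ← lintegral_const_mul _ (by fun_prop)]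
  refine lintegral_mono fun τ => ?_
  exact level_contribution_le μ hu hα hα' (hP τ) (A := Prod.mk τ ⁻¹' A) rfl

/-- Splitting at t = M leaves t^{α-b-1} below and M^α t^{-b-1} above; b < α gives convergence at 0
and b > 0 at infinity. -/
theorem lintegral_rpow_mul_min_rpow_le {b α : ℝ} (hb : 0 < b) (hbα : b < α) (M : ℝ≥0∞) :
    ∫⁻ t in Ioi (0 : ℝ), ENNReal.ofReal t ^ (-b - 1) * min M (ENNReal.ofReal t) ^ α ≤
      ((ENNReal.ofReal (α - b))⁻¹ + (ENNReal.ofReal b)⁻¹) * M ^ (α - b) := by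
  have hα : 0 < α := hb.trans hbα
  have hS := measurableSet_ofReal_lt M
  calc ∫⁻ t in Ioi (0 : ℝ), ENNReal.ofReal t ^ (-b - 1) * min M (ENNReal.ofReal t) ^ α
      ≤ ∫⁻ t in Ioi (0 : ℝ), ({t : ℝ | ENNReal.ofReal t < M}.indicator
          (fun t => ENNReal.ofReal t ^ (α - b - 1)) t + M ^ α *
          {t : ℝ | ENNReal.ofReal t < M}ᶜ.indicator (fun t => ENNReal.ofReal t ^ (-b - 1)) t) := by
        refine setLIntegral_mono' measurableSet_Ioi fun t (ht : 0 < t) => ?_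
        have h0 : ENNReal.ofReal t ≠ 0 := by simpa using ht
        by_cases h : t ∈ {t : ℝ | ENNReal.ofReal t < M}
        · refine le_trans (le_of_eq ?_) le_self_add
          rw [indicator_of_mem h, min_eq_right (le_of_lt h),
            ← ENNReal.rpow_add _ _ h0 ENNReal.ofReal_ne_top]
          congr 1; ring
        · refine le_trans (le_of_eq ?_) le_add_self
          rw [indicator_of_mem (mem_compl h), min_eq_left (not_lt.1 h), mul_comm]
    _ = M ^ (α - b) / ENNReal.ofReal (α - b) + M ^ α * ∫⁻ t in Ioi (0 : ℝ),
          {t : ℝ | ENNReal.ofReal t < M}ᶜ.indicator (fun t => ENNReal.ofReal t ^ (-b - 1)) t := by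
        rw [lintegral_add_left (Measurable.indicator (by fun_prop) hS), lintegral_const_mul _
          (Measurable.indicator (by fun_prop) hS.compl),
          lintegral_rpow_indicator_lt (sub_pos.2 hbα)]
    _ ≤ M ^ (α - b) / ENNReal.ofReal (α - b) + M ^ α * (M ^ (-b) / ENNReal.ofReal b) := by
        gcongr; exact lintegral_rpow_indicator_ge_le hb M
    _ ≤ M ^ (α - b) / ENNReal.ofReal (α - b) + M ^ (α - b) / ENNReal.ofReal b := by
        rw [← mul_div_assoc]
        gcongr
        rcases eq_or_ne M 0 with rfl | h0
        · simp [hα]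
        rcases eq_or_ne M ∞ with rfl | ht
        · simp [hb, hbα]
        rw [← ENNReal.rpow_add _ _ h0 ht, sub_eq_add_neg]
    _ = _ := by simp only [div_eq_mul_inv]; ring

/-- `levelMeasure` depends only on |τ|, so negative levels double the integral over positive ones.
-/
theorem lintegral_levelMeasure_rpow_le {q : ℝ} (hq : 0 < q) :
    ∫⁻ τ, levelMeasure μ u τ ^ (1 / q) ≤
      2 * (ENNReal.ofReal (1 / q) * lorentzNorm μ q 1 fun x => ‖u x‖ₑ) := by
  have hpos : ∫⁻ τ in Ioi (0 : ℝ), levelMeasure μ u τ ^ (1 / q) ≤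
      ENNReal.ofReal (1 / q) * lorentzNorm μ q 1 fun x => ‖u x‖ₑ := by
    refine le_trans (le_of_eq ?_) (lintegral_measure_rpow_le_lorentzNorm hq _)
    refine setLIntegral_congr_fun measurableSet_Ioi fun τ (hτ : 0 < τ) => ?_
    simp only [levelMeasure, abs_of_pos hτ, ← ofReal_norm, Real.norm_eq_abs]
    congr 2
    ext x
    exact (ENNReal.ofReal_le_ofReal_iff (abs_nonneg _)).symm
  have hneg : ∫⁻ τ in Iic (0 : ℝ), levelMeasure μ u τ ^ (1 / q) =
      ∫⁻ τ in Ioi (0 : ℝ), levelMeasure μ u τ ^ (1 / q) := by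
    rw [← setLIntegral_congr Iio_ae_eq_Iic, ← lintegral_indicator measurableSet_Iio,
      ← lintegral_indicator measurableSet_Ioi, ← lintegral_neg_eq_self]
    refine lintegral_congr fun τ => ?_
    simp [indicator, levelMeasure]
  rw [← lintegral_add_compl _ measurableSet_Iic (A := Iic (0 : ℝ)), compl_Iic, hneg, ← two_mul]
  gcongr

/-- Interpolation bound for the difference integral in terms of the `L¹` modulus of continuity. -/
theorem lorentzNorm_differenceIntegral_le (hn : 2 ≤ Module.finrank ℝ E) (hu : Measurable u)
    {α : ℝ} (hα : 0 < α) (hα' : α < 1) {V : ℝ≥0∞}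
    (hV : ∀ h, ∫⁻ x, ‖u (x + h) - u x‖ₑ ∂μ ≤ ‖h‖ₑ * V) :
    lorentzNorm μ (Module.finrank ℝ E / (Module.finrank ℝ E - α)) 1
        (differenceIntegral μ (1 - α) u) ≤
      μ.toSphere univ * ((ENNReal.ofReal α)⁻¹ + 2 * (ENNReal.ofReal (1 - α))⁻¹) *
        ((ENNReal.ofReal (α - α / Module.finrank ℝ E))⁻¹ +
          (ENNReal.ofReal (α / Module.finrank ℝ E))⁻¹) *
        (4 * 2 ^ Module.finrank ℝ E) ^ (1 - α) * 2 ^ α * V ^ (1 - α) *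
        (lorentzNorm μ (Module.finrank ℝ E / (Module.finrank ℝ E - 1)) 1 fun x => ‖u x‖ₑ) ^ α := by
  obtain ⟨P, hPm, hP, hPV⟩ := exists_levelVariation μ hu hV
  set n : ℝ := ((Module.finrank ℝ E : ℕ) : ℝ) with hndef
  have hn2 : (2 : ℝ) ≤ n := by rw [hndef]; exact_mod_cast hn
  have hn0 : 0 < n := by linarith
  set C₁ := μ.toSphere univ * ((ENNReal.ofReal α)⁻¹ + 2 * (ENNReal.ofReal (1 - α))⁻¹)
  set C₂ := (ENNReal.ofReal (α - α / n))⁻¹ + (ENNReal.ofReal (α / n))⁻¹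
  set M := levelMeasure μ u with hMdef
  have hM : Measurable M := measurable_levelMeasure μ hu
  have hb : 0 < α / n := by positivity
  have hbα : α / n < α := div_lt_self hα (by linarith)
  have hq : 1 / (n / (n - α)) - 1 - 1 = -(α / n) - 1 := by
    rw [one_div_div]; field_simp; ring
  have hκ : 1 / (n / (n - 1)) * α = α - α / n := by
    rw [one_div_div]; field_simp
  have hκ1 : 1 / (n / (n - 1)) ≤ 1 := by
    rw [one_div_div, div_le_one hn0]; linarith
  set L := lorentzNorm μ (n / (n - 1)) 1 fun x => ‖u x‖ₑ
  rw [lorentzNorm_one_eq, hq]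
  calc ∫⁻ t in Ioi (0 : ℝ), ENNReal.ofReal t ^ (-(α / n) - 1) *
        ∫⁻ s in Ioc 0 t, rearrangement μ (differenceIntegral μ (1 - α) u) s
      ≤ ∫⁻ t in Ioi (0 : ℝ), ENNReal.ofReal t ^ (-(α / n) - 1) *
          (C₁ * ∫⁻ τ, P τ ^ (1 - α) * min (M τ) (ENNReal.ofReal t) ^ α) := by
        refine lintegral_mono fun t => ?_
        gcongr
        exact setLIntegral_rearrangement_differenceIntegral_le μ hu hPm hα hα' hP t
    _ = ∫⁻ t in Ioi (0 : ℝ), C₁ * ∫⁻ τ, P τ ^ (1 - α) *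
          (ENNReal.ofReal t ^ (-(α / n) - 1) * min (M τ) (ENNReal.ofReal t) ^ α) := by
        refine lintegral_congr fun t => ?_
        rw [mul_left_comm, ← lintegral_const_mul _ (by fun_prop)]
        congr 1
        refine lintegral_congr fun τ => ?_
        ring
    _ = C₁ * ∫⁻ τ, P τ ^ (1 - α) * ∫⁻ t in Ioi (0 : ℝ),
          (ENNReal.ofReal t ^ (-(α / n) - 1) * min (M τ) (ENNReal.ofReal t) ^ α) := by
        have hF : Measurable fun p : ℝ × ℝ => P p.2 ^ (1 - α) *
          (ENNReal.ofReal p.1 ^ (-(α / n) - 1) * min (M p.2) (ENNReal.ofReal p.1) ^ α) := by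
          fun_prop
        rw [lintegral_const_mul _ hF.lintegral_prod_right', lintegral_lintegral_swap
          hF.aemeasurable]
        congr 1
        refine lintegral_congr fun τ => ?_
        simp only
        rw [lintegral_const_mul _ (by fun_prop)]
    _ ≤ C₁ * ∫⁻ τ, P τ ^ (1 - α) * (C₂ * M τ ^ (α - α / n)) := by
        gcongr with τ
        exact lintegral_rpow_mul_min_rpow_le hb hbα (M τ)
    _ = C₁ * C₂ * ∫⁻ τ, P τ ^ (1 - α) * (M τ ^ (1 / (n / (n - 1)))) ^ α := by
        rw [mul_assoc C₁ C₂, ← lintegral_const_mul C₂ (by fun_prop)]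
        congr 1
        refine lintegral_congr fun τ => ?_
        rw [← ENNReal.rpow_mul, hκ]
        ring
    _ ≤ C₁ * C₂ * ((∫⁻ τ, P τ) ^ (1 - α) * (∫⁻ τ, M τ ^ (1 / (n / (n - 1)))) ^ α) := by
        gcongr
        -- Hölder with exponents 1/(1 − α) and 1/α.
        exact ENNReal.lintegral_mul_norm_pow_le hPm.aemeasurable (by fun_prop) (by linarith) hα.le
          (by ring)
    _ ≤ C₁ * C₂ * ((4 * 2 ^ Module.finrank ℝ E * V) ^ (1 - α) * (2 * (1 * L)) ^ α) := by
        have h1 : (0 : ℝ) ≤ 1 - α := by linarith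
        gcongr
        refine (lintegral_levelMeasure_rpow_le μ (div_pos hn0 (by linarith))).trans ?_
        gcongr
        simpa using hκ1
    _ = _ := by
        rw [ENNReal.mul_rpow_of_nonneg _ _ (by linarith : (0 : ℝ) ≤ 1 - α), one_mul,
          ENNReal.mul_rpow_of_nonneg _ _ hα.le]
        ring

end Difference

/-! ### Reduction to a measurable representative -/

variable {d : ℕ} {u v : EuclideanSpace ℝ (Fin d) → ℝ}

theorem totalVariation_congr_ae (h : u =ᵐ[volume] v) : totalVariation u = totalVariation v := by
  unfold totalVariation
  have : ∀ Φ : EuclideanSpace ℝ (Fin d) → EuclideanSpace ℝ (Fin d),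
      ∫ x, u x * divergence Φ x = ∫ x, v x * divergence Φ x := fun Φ =>
    integral_congr_ae (by filter_upwards [h] with x hx; rw [hx])
  simp_rw [this]

theorem fracD_eq_differenceIntegral (s : ℝ) (u : EuclideanSpace ℝ (Fin d) → ℝ)
    (x : EuclideanSpace ℝ (Fin d)) : fracD s u x = differenceIntegral volume s u x := by
  rw [fracD, differenceIntegral, ← lintegral_add_left_eq_self _ x]
  refine lintegral_congr fun h => ?_
  rw [sub_add_cancel_left, enorm_neg, ← neg_sub (u (x + h)), enorm_neg, div_eq_mul_inv,
    ← ENNReal.rpow_neg, finrank_euclideanSpace_fin]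
  congr 2
  ring

theorem fracD_ae_eq_differenceIntegral (s : ℝ) (h : u =ᵐ[volume] v) :
    fracD s u =ᵐ[volume] differenceIntegral volume s v := by
  filter_upwards [h] with x hx
  rw [← fracD_eq_differenceIntegral]
  refine lintegral_congr_ae ?_
  filter_upwards [h] with y hy
  rw [hx, hy]

end LorentzBV

/-! ### The interpolation inequality on ℝ^d -/

theorem theorem4p1 (d : ℕ) (hd : 2 ≤ d) (α : ℝ) (hα₀ : 0 < α) (hα₁ : α < 1) :
    ∃ C : ℝ, 0 < C ∧ ∀ u : EuclideanSpace ℝ (Fin d) → ℝ, LorentzBV.IsBV u →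
      LorentzBV.lorentzNorm volume ((d : ℝ) / ((d : ℝ) - α)) 1 (LorentzBV.fracD (1 - α) u) ≤
        ENNReal.ofReal C * LorentzBV.totalVariation u ^ (1 - α) *
          LorentzBV.lorentzNorm volume ((d : ℝ) / ((d : ℝ) - 1)) 1 (fun x => ‖u x‖ₑ) ^ α := by
  have : Nonempty (Fin d) := ⟨⟨0, by lia⟩⟩
  have hd2 : (2 : ℝ) ≤ d := by exact_mod_cast hd
  have hb : 0 < α / d := by positivity
  have hbα : α / d < α := div_lt_self hα₀ (by linarith)
  set C₀ : ℝ≥0∞ := (volume : Measure (EuclideanSpace ℝ (Fin d))).toSphere univ *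
    ((ENNReal.ofReal α)⁻¹ + 2 * (ENNReal.ofReal (1 - α))⁻¹) *
    ((ENNReal.ofReal (α - α / d))⁻¹ + (ENNReal.ofReal (α / d))⁻¹) *
    (4 * 2 ^ d) ^ (1 - α) * 2 ^ α with hC₀
  have hinv : ∀ {z : ℝ}, 0 < z → (ENNReal.ofReal z)⁻¹ ≠ ∞ := fun hz => by simpa using hz
  have hfin : C₀ ≠ ∞ := by
    refine ENNReal.mul_ne_top (ENNReal.mul_ne_top (ENNReal.mul_ne_top (ENNReal.mul_ne_top
      (measure_ne_top _ _) ?_) ?_) ?_) ?_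
    · exact ENNReal.add_ne_top.2 ⟨hinv hα₀, ENNReal.mul_ne_top (by simp) (hinv (by linarith))⟩
    · exact ENNReal.add_ne_top.2 ⟨hinv (by linarith), hinv hb⟩
    · exact ENNReal.rpow_ne_top_of_nonneg (by linarith)
        (ENNReal.mul_ne_top (by simp) (ENNReal.pow_ne_top (by simp)))
    · exact ENNReal.rpow_ne_top_of_nonneg hα₀.le (by simp)
  -- Adding 1 makes positivity immediate.
  refine ⟨C₀.toReal + 1, by positivity, fun u hu => ?_⟩
  have hC : C₀ ≤ ENNReal.ofReal (C₀.toReal + 1) := by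
    rw [← ENNReal.ofReal_toReal hfin]
    exact ENNReal.ofReal_le_ofReal (by simp [ENNReal.toReal_ofReal])
  -- The level-set argument needs a genuinely measurable function; all three quantities in the
  -- inequality are unchanged under almost everywhere modification of `u`.
  obtain ⟨v, hvm, huv⟩ := hu.1.aestronglyMeasurable.aemeasurable
  have hvi : Integrable v := hu.1.congr huv
  have key := LorentzBV.lorentzNorm_differenceIntegral_le volume
    (by rw [finrank_euclideanSpace_fin]; exact hd) hvm hα₀ hα₁
    (LorentzBV.lintegral_enorm_translate_sub_le hvi)
  simp only [finrank_euclideanSpace_fin] at key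
  have hnorm : (fun x => ‖u x‖ₑ) =ᵐ[volume] fun x => ‖v x‖ₑ := by
    filter_upwards [huv] with x hx
    rw [hx]
  rw [LorentzBV.lorentzNorm_congr_ae (LorentzBV.fracD_ae_eq_differenceIntegral (1 - α) huv),
    LorentzBV.lorentzNorm_congr_ae hnorm, LorentzBV.totalVariation_congr_ae huv]
  refine key.trans ?_
  gcongr
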